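/- Let $N\ge 2$ agents with positions $p_i(t)\in\mathbb{R}^2$ obey $\dot p_i=u_i$. Let $G^*=(V^*,E^*)$ be a directed graph on $V^*=\{1,\dots,N\}$ in which agent $1$ has out-degree $0$, agent $2$ has out-degree $1$, every agent $k\ge 3$ has out-degree $2$, and every edge $(j,i)\in E^*$ (from $j$ to $i$) satisfies $i<j$. Let $p^*=[p_1^*,\dots,p_N^*]$ with pairwise distinct $p_i^*\in\mathbb{R}^2$ be the desired formation, and put $d_{ji}=\|p_j^*-p_i^*\|$, $\tilde p_{ji}=p_j-p_i$, $z_{ji}=\|\tilde p_{ji}\|^2-d_{ji}^2$. A triangle is a triple $i<j<k$ with $(k,i),(k,j)\in E^*$; let $S_{ijk}=\frac12\det\begin{bmatrix}1&1&1\\p_i&p_j&p_k\end{bmatrix}$ be its signed area, $S^*_{ijk}$ the same for $p^*$, $\tilde S_{ijk}=S_{ijk}-S_{ijk}^*$, and $\chi(p)$ the vector of all $S_{ijk}$ over the triangles. Let $z$ and $\tilde S$ be the vectors of all $z_{ji}$, $(j,i)\in E^*$, and of all $\tilde S_{ijk}$. Let $\mathrm{SCgt}(F^*)$ be the set of configurations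 $q$ with $\|q_i-q_j\|=d_{ji}$ for all $i,j\in V^*$ and $\chi(q)=\chi(p^*)$ (strong congruence to the desired formation). With constants $\alpha_k>0$ ($k\ge2$), $\beta_k>0$ ($k\ge 3$) and $J=\begin{bmatrix}0&1\\-1&0\end{bmatrix}$, use the control $u_1=0$, $u_2=-\alpha_2z_{21}\tilde p_{21}$ and $$u_k=-\alpha_k(z_{ki}\tilde p_{ki}+z_{kj}\tilde p_{kj})-\beta_k\tilde S_{ijk}J^{\top}(\tilde p_{ki}-\tilde p_{kj})$$ for every triangle $i<j<k$. For $\delta_1,\delta_2,\delta_3>0$ let $R=2\delta_1^2\delta_2^2-\delta_1^4+2\delta_1^2\delta_3^2-\delta_2^4+2\delta_2^2\delta_3^2-\delta_3^4$, and call $\underline\gamma>0$ a gain bound for $(\delta_1,\delta_2,\delta_3)$ if for every $\gamma>\underline\gamma$ the equation $ax^4+bx^3+cx^2+dx+e=0$ has no real solution, where $a=-2\delta_1^2(\gamma-2)^2$, $b=\delta_1(\gamma^2-4)\sqrt R$, $c=-\frac12\delta_1^4\gamma^3+\delta_1^2(\frac32\delta_1^2+\delta_2^2+\delta_3^2)\gamma^2-4\delta_1^2(\delta_2^2+\delta_3^2)\gamma$,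 $d=\frac14\delta_1\gamma^2(2\delta_1^2\gamma-3\delta_1^2-2\delta_2^2-2\delta_3^2)\sqrt R$, $e=-\frac18\delta_1^2\gamma^3R$. **Theorem.** Suppose that every triangle $i<j<k$ satisfies $\left|\dfrac{d_{ki}^2-d_{kj}^2}{d_{ji}^2}\right|<2\sqrt2$. (i) For every triangle with $S^*_{ijk}\ne0$ and $d_{ki}\ne d_{kj}$ a gain bound for $(d_{ji},d_{kj},d_{ki})$ exists. (ii) Suppose that for every triangle $$\frac{\beta_k}{\alpha_k}>\begin{cases}\dfrac{d_{kj}^2-d_{ji}^2/4}{d_{ji}^2},&d_{ki}=d_{kj},\\[2mm]\underline\gamma_k,&d_{ki}\ne d_{kj},\end{cases}$$ where $\underline\gamma_k$ is a gain bound for $(d_{ji},d_{kj},d_{ki})$. Then $[z,\tilde S]=0$ is asymptotically stable (Lyapunov stable and locally attractive) along the closed-loop motions. Moreover, for every initial configuration with $p_1(0)\ne p_2(0)$, the closed-loop system has a solution on $[0,\infty)$, and along every such solution $[z,\tilde S]\to0$ and $F(t)\to\mathrm{SCgt}(F^*)$ as $t\to\infty$; that is, the distance of $p(t)$ to $\mathrm{SCgt}(F^*)$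 tends to $0$, $\|p_j(t)-p_i(t)\|\to d_{ji}$ for all $i,j\in V^*$, and $\chi(p(t))\to\chi(p^*)$. -/

import Mathlib

open Filter Topology

noncomputable section

/-- The Euclidean plane. -/
abbrev Plane : Type := EuclideanSpace ℝ (Fin 2)

/-- The matrix `J = [0 1; -1 0]`. -/
def Jmat : Matrix (Fin 2) (Fin 2) ℝ := !![0, 1; -1, 0]

/-- The vector `Jᵀ v`. -/
def JT (v : Plane) : Plane := WithLp.toLp 2 (Matrix.mulVec Jmat.transpose v.ofLp)

/-- Signed area of the triangle with vertices `a, b, c`. -/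
def signedArea (a b c : Plane) : ℝ :=
  1 / 2 * Matrix.det !![1, 1, 1; a 0, b 0, c 0; a 1, b 1, c 1]

/-- Leader-first-follower directed graphs on the agents `0, 1, …, n + 1` (so the leader is agent
`0` and the first follower is agent `1`): the leader has out-degree `0`, the first follower has
out-degree `1`, every other agent has out-degree `2`, and every edge points from an agent to an
agent with a smaller label. -/
structure IsLFF {n : ℕ} (G : Digraph (Fin (n + 2))) : Prop where
  out_leader : {j | G.Adj 0 j}.ncard = 0
  out_first : {j | G.Adj 1 j}.ncard = 1
  out_ordinary : ∀ k : Fin (n + 2), 1 < k → {j | G.Adj k j}.ncard = 2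
  descending : ∀ j i : Fin (n + 2), G.Adj j i → i < j

/-- `i, j, k` are the vertices of one of the triangles of the triangulated graph: `i < j < k`, and
`k` has outgoing edges to `i` and to `j`. -/
def IsTri {n : ℕ} (G : Digraph (Fin (n + 2))) (i j k : Fin (n + 2)) : Prop :=
  i < j ∧ j < k ∧ G.Adj k i ∧ G.Adj k j

/-- Directed edges `(j, i)`. -/
abbrev EdgeIdx {n : ℕ} (G : Digraph (Fin (n + 2))) : Type :=
  {e : Fin (n + 2) × Fin (n + 2) // G.Adj e.1 e.2}

/-- Triangles `(i, j, k)`. -/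
abbrev TriIdx {n : ℕ} (G : Digraph (Fin (n + 2))) : Type :=
  {T : Fin (n + 2) × Fin (n + 2) × Fin (n + 2) // IsTri G T.1 T.2.1 T.2.2}

/-- The vector `χ(q)` of the signed areas of all triangles of the framework `(G, q)`. -/
def chi {n : ℕ} (G : Digraph (Fin (n + 2))) (q : Fin (n + 2) → Plane) : TriIdx G → ℝ :=
  fun T => signedArea (q T.1.1) (q T.1.2.1) (q T.1.2.2)

/-- The configurations `q` for which `(G, q)` is strongly congruent to `(G, ps)`. -/
def SCgt {n : ℕ} (G : Digraph (Fin (n + 2))) (ps : Fin (n + 2) → Plane) :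
    Set (Fin (n + 2) → Plane) :=
  {q | (∀ i j, ‖q i - q j‖ = ‖ps i - ps j‖) ∧ chi G q = chi G ps}

/-- The desired distance `d_{ji}`. -/
def dist_des {n : ℕ} (ps : Fin (n + 2) → Plane) (j i : Fin (n + 2)) : ℝ := ‖ps j - ps i‖

/-- The distance error `z_{ji}`. -/
def zErr {n : ℕ} (ps p : Fin (n + 2) → Plane) (j i : Fin (n + 2)) : ℝ :=
  ‖p j - p i‖ ^ 2 - dist_des ps j i ^ 2

/-- The area error of the triangle `i, j, k`. -/
def areaErr {n : ℕ} (ps p : Fin (n + 2) → Plane) (i j k : Fin (n + 2)) : ℝ :=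
  signedArea (p i) (p j) (p k) - signedArea (ps i) (ps j) (ps k)

/-- The stacked error vector: all distance errors over the edges, and all area errors over the
triangles. -/
def stackedErr {n : ℕ} (G : Digraph (Fin (n + 2))) (ps p : Fin (n + 2) → Plane) :
    (EdgeIdx G → ℝ) × (TriIdx G → ℝ) :=
  (fun e => zErr ps p e.1.1 e.1.2, fun T => areaErr ps p T.1.1 T.1.2.1 T.1.2.2)

/-- `p` solves, for all times `t ≥ 0`, the closed-loop system: single integrators under the
distance-plus-signed-area gradient control. -/
structure IsClosedLoop {n : ℕ} (G : Digraph (Fin (n + 2))) (ps : Fin (n + 2) → Plane)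
    (α β : Fin (n + 2) → ℝ) (p : ℝ → Fin (n + 2) → Plane) : Prop where
  leader : ∀ t : ℝ, 0 ≤ t → HasDerivWithinAt (fun s => p s 0) 0 (Set.Ici 0) t
  first : ∀ t : ℝ, 0 ≤ t →
    HasDerivWithinAt (fun s => p s 1)
      (-((α 1 * zErr ps (p t) 1 0) • (p t 1 - p t 0))) (Set.Ici 0) t
  ordinary : ∀ i j k : Fin (n + 2), IsTri G i j k → ∀ t : ℝ, 0 ≤ t →
    HasDerivWithinAt (fun s => p s k)
      (-(α k • (zErr ps (p t) k i • (p t k - p t i) + zErr ps (p t) k j • (p t k - p t j)))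
        - (β k * areaErr ps (p t) i j k) • JT ((p t k - p t i) - (p t k - p t j)))
      (Set.Ici 0) t

/-- Asymptotic stability of the point `x₀` for a family of paths (the motions of a system, followed
for times `t ≥ 0`): Lyapunov stability together with local attractivity. -/
def IsAsympStable {X : Type*} [TopologicalSpace X] (motions : Set (ℝ → X)) (x₀ : X) : Prop :=
  (∀ U ∈ 𝓝 x₀, ∃ W ∈ 𝓝 x₀, ∀ x ∈ motions, x 0 ∈ W → ∀ t : ℝ, 0 ≤ t → x t ∈ U) ∧
  (∃ W ∈ 𝓝 x₀, ∀ x ∈ motions, x 0 ∈ W → Tendsto x atTop (𝓝 x₀))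

/-- The quartic polynomial in `x` attached to a triangle with side lengths `δ₁, δ₂, δ₃` and to a
gain ratio `γ`. -/
def gainQuartic (δ₁ δ₂ δ₃ γ x : ℝ) : ℝ :=
  let R : ℝ := 2 * δ₁ ^ 2 * δ₂ ^ 2 - δ₁ ^ 4 + 2 * δ₁ ^ 2 * δ₃ ^ 2 - δ₂ ^ 4
    + 2 * δ₂ ^ 2 * δ₃ ^ 2 - δ₃ ^ 4
  let a : ℝ := -2 * δ₁ ^ 2 * (γ - 2) ^ 2
  let b : ℝ := δ₁ * (γ ^ 2 - 4) * Real.sqrt R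
  let c : ℝ := -(1 / 2) * δ₁ ^ 4 * γ ^ 3 + δ₁ ^ 2 * (3 / 2 * δ₁ ^ 2 + δ₂ ^ 2 + δ₃ ^ 2) * γ ^ 2
    - 4 * δ₁ ^ 2 * (δ₂ ^ 2 + δ₃ ^ 2) * γ
  let d : ℝ := 1 / 4 * δ₁ * γ ^ 2 * (2 * δ₁ ^ 2 * γ - 3 * δ₁ ^ 2 - 2 * δ₂ ^ 2 - 2 * δ₃ ^ 2)
    * Real.sqrt R
  let e : ℝ := -(1 / 8) * δ₁ ^ 2 * γ ^ 3 * R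
  a * x ^ 4 + b * x ^ 3 + c * x ^ 2 + d * x + e

/-- `g` is an admissible lower bound for the gain ratio of a triangle with side lengths
`δ₁, δ₂, δ₃`: the quartic has no real root for any `γ > g`. -/
def IsGainBound (δ₁ δ₂ δ₃ g : ℝ) : Prop :=
  0 < g ∧ ∀ γ : ℝ, g < γ → ∀ x : ℝ, gainQuartic δ₁ δ₂ δ₃ γ x ≠ 0

end

noncomputable section

/-! The graph makes the closed loop a cascade: each agent is driven only by agents with smaller
labels, so everything reduces to one agent with two neighbours `a`, `b` and target `c`, followed by
induction on labels.

With the neighbours at their targets the agent follows the negative gradient of `agentPotential`.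
Place the base at `(-1, 0)`, `(1, 0)` and the apex at `(A, H)`. Eliminating the abscissa from the
equilibrium equations leaves `(Y - H) * normalizedQuartic = 0`, where the second factor is
`gainQuartic` up to a nonzero scalar. Hence above a gain bound `c` is the only rest point; the
isosceles case `A = 0` is solved by hand. The shape hypothesis on a triangle is exactly `A ^ 2 < 8`,
which makes the quartic positive for large gain ratio, by completing squares.

When the neighbours only converge to `a` and `b`, the rate of change of the potential is a small
perturbation of a strictly negative one on compact sets away from `c`. Trajectories stay bounded
because the distance terms grow like the fourth power of the norm and dominate the area term. So the
agent converges to `c`, and stays near `c` if everything starts and remains nearby.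

The cascade starts after a rigid motion fixing the frame: leader at its desired position, first
follower on the ray towards its own. The follower stays on that ray, and the control commutes with
rigid motions. Errors near zero determine an aligned configuration up to small displacement, which
turns stability of positions into stability of errors. -/

/-! ### Coordinates in the plane. -/

theorem JT_apply_zero (v : Plane) : JT v 0 = -v 1 := by
  simp [JT, Jmat]

theorem JT_apply_one (v : Plane) : JT v 1 = v 0 := by
  simp [JT, Jmat]

theorem signedArea_eq (a b c : Plane) :
    signedArea a b c = 1 / 2 * ((b 0 - a 0) * (c 1 - a 1) - (b 1 - a 1) * (c 0 - a 0)) := by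
  simp [signedArea, Matrix.det_fin_three]; ring

theorem plane_norm_sq (v : Plane) : ‖v‖ ^ 2 = v 0 ^ 2 + v 1 ^ 2 := by
  simp [EuclideanSpace.norm_sq_eq, Fin.sum_univ_two]

theorem plane_inner (v w : Plane) : inner ℝ v w = v 0 * w 0 + v 1 * w 1 := by
  simp [PiLp.inner_apply, Fin.sum_univ_two]; ring

theorem plane_ext {v w : Plane} (h0 : v 0 = w 0) (h1 : v 1 = w 1) : v = w := by
  ext i; fin_cases i <;> assumption

theorem norm_sq_pos_of_ne {a b : Plane} (h : a ≠ b) :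
    0 < (b 0 - a 0) ^ 2 + (b 1 - a 1) ^ 2 := by
  have := norm_pos_iff.2 (sub_ne_zero.2 h.symm)
  have h2 := plane_norm_sq (b - a)
  simp only [PiLp.sub_apply] at h2
  rw [← h2]; positivity

/-- Coordinates of a point relative to a base segment. -/
theorem exists_base_coords {a b : Plane} (h : a ≠ b) (x : Plane) : ∃ X Y : ℝ,
    x 0 = (a 0 + b 0) / 2 + X / 2 * (b 0 - a 0) - Y / 2 * (b 1 - a 1) ∧
    x 1 = (a 1 + b 1) / 2 + X / 2 * (b 1 - a 1) + Y / 2 * (b 0 - a 0) := by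
  have hN := norm_sq_pos_of_ne h
  set N := (b 0 - a 0) ^ 2 + (b 1 - a 1) ^ 2 with hNdef
  refine ⟨2 * ((x 0 - (a 0 + b 0) / 2) * (b 0 - a 0) + (x 1 - (a 1 + b 1) / 2) * (b 1 - a 1)) / N,
    2 * ((x 1 - (a 1 + b 1) / 2) * (b 0 - a 0) - (x 0 - (a 0 + b 0) / 2) * (b 1 - a 1)) / N,
    ?_, ?_⟩
  · field_simp; rw [hNdef]; ring
  · field_simp; rw [hNdef]; ring

/-! ### Rest points of one agent and the gain quartic. -/

/-- The velocity of an agent at `x` whose neighbours are at `y` and `z`. -/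
def agentField (α β d₁ d₂ S : ℝ) (y z x : Plane) : Plane :=
  -(α • ((‖x - y‖ ^ 2 - d₁ ^ 2) • (x - y) + (‖x - z‖ ^ 2 - d₂ ^ 2) • (x - z)))
    - (β * (signedArea y z x - S)) • JT ((x - y) - (x - z))

theorem agentField_apply_zero (α β d₁ d₂ S : ℝ) (y z x : Plane) :
    agentField α β d₁ d₂ S y z x 0 = -(α * ((‖x - y‖ ^ 2 - d₁ ^ 2) * (x 0 - y 0)
      + (‖x - z‖ ^ 2 - d₂ ^ 2) * (x 0 - z 0))) + β * (signedArea y z x - S) * (z 1 - y 1) := by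
  simp [agentField, JT_apply_zero]; ring

theorem agentField_apply_one (α β d₁ d₂ S : ℝ) (y z x : Plane) :
    agentField α β d₁ d₂ S y z x 1 = -(α * ((‖x - y‖ ^ 2 - d₁ ^ 2) * (x 1 - y 1)
      + (‖x - z‖ ^ 2 - d₂ ^ 2) * (x 1 - z 1))) - β * (signedArea y z x - S) * (z 0 - y 0) := by
  simp [agentField, JT_apply_one]; ring

/-- The quartic in normalized coordinates (base of length `2`, apex at `(A, H)`). -/
def normalizedQuartic (γ A H Y : ℝ) : ℝ :=
  (γ * H + (2 - γ) * Y) ^ 2 * (γ + Y ^ 2 + Y * H)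
    + A ^ 2 * γ * (2 * Y ^ 2 + Y * (γ * H + (2 - γ) * Y))

/-- By Heron, `R` is sixteen times the squared area, that is `(s ^ 2 * |H|) ^ 2`, so the square root
disappears. It leaves `|H|`, since side lengths do not see orientation. -/
theorem gainQuartic_eq {s δ₂ δ₃ A H : ℝ} (hs : 0 < s)
    (h2 : δ₂ ^ 2 = s ^ 2 / 4 * ((A - 1) ^ 2 + H ^ 2))
    (h3 : δ₃ ^ 2 = s ^ 2 / 4 * ((A + 1) ^ 2 + H ^ 2)) (γ Y : ℝ) :
    gainQuartic s δ₂ δ₃ γ (s / 2 * Y) = -(s ^ 6 / 8) * normalizedQuartic γ A |H| Y := by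
  have hR : 2 * s ^ 2 * δ₂ ^ 2 - s ^ 4 + 2 * s ^ 2 * δ₃ ^ 2 - δ₂ ^ 4
      + 2 * δ₂ ^ 2 * δ₃ ^ 2 - δ₃ ^ 4 = (s ^ 2 * |H|) ^ 2 := by
    have h4 : δ₂ ^ 4 = (δ₂ ^ 2) ^ 2 := by ring
    have h5 : δ₃ ^ 4 = (δ₃ ^ 2) ^ 2 := by ring
    rw [h4, h5, h2, h3, mul_pow (s ^ 2) |H|, sq_abs]; ring
  unfold gainQuartic
  simp only []
  rw [hR, Real.sqrt_sq (by positivity), h2, h3, ← sq_abs H]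
  unfold normalizedQuartic
  ring

/-- Bound `Y ^ 2 + Y * H` below by `-H ^ 2 / 4` and complete the square in `2 * Y ^ 2 + Y * D`,
which costs `D ^ 2 / 8`. The remaining coefficient of `D ^ 2` is positive exactly when `γ * (8 - A ^
2) > 2 * H ^ 2`. -/
theorem normalizedQuartic_pos {γ A H : ℝ} (hH : 0 < H) (hγ : 0 < γ) (hA0 : A ≠ 0)
    (hA : A ^ 2 < 8) (hg : 2 * H ^ 2 / (8 - A ^ 2) < γ) (Y : ℝ) :
    0 < normalizedQuartic γ A H Y := by
  have h8 : 0 < 8 - A ^ 2 := by linarith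
  rw [div_lt_iff₀ h8] at hg
  unfold normalizedQuartic
  set D := γ * H + (2 - γ) * Y with hD
  have key : 0 < D ^ 2 * (γ - H ^ 2 / 4) + A ^ 2 * γ * (2 * Y ^ 2 + Y * D) := by
    have hsq : D ^ 2 * (γ - H ^ 2 / 4) + A ^ 2 * γ * (2 * Y ^ 2 + Y * D)
      = D ^ 2 * (γ * (8 - A ^ 2) - 2 * H ^ 2) / 8 + 2 * A ^ 2 * γ * (Y + D / 4) ^ 2 := by ring
    rw [hsq]
    have hp : 0 < γ * (8 - A ^ 2) - 2 * H ^ 2 := by linarith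
    by_cases hD0 : D = 0
    · have hY : Y ≠ 0 := by
        rintro rfl
        have : γ * H = 0 := by rw [← hD0, hD]; ring
        exact (mul_pos hγ hH).ne' this
      rw [hD0]
      have : 0 < 2 * A ^ 2 * γ * (Y + 0 / 4) ^ 2 := by
        rw [zero_div, add_zero]; positivity
      linarith
    · have h1 : 0 < D ^ 2 := by positivity
      have h2 : 0 ≤ 2 * A ^ 2 * γ * (Y + D / 4) ^ 2 := by positivity
      have h3 := mul_pos h1 hp
      linarith
  nlinarith [mul_nonneg (sq_nonneg D) (sq_nonneg (Y + H / 2))]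

theorem equilibrium_unique_isosceles {γ H X Y : ℝ} (hH : H ^ 2 / 4 < γ)
    (h0 : X * (X ^ 2 + Y ^ 2 - H ^ 2) + 2 * X = 0)
    (h1 : Y * (X ^ 2 + Y ^ 2 - H ^ 2) + γ * (Y - H) = 0) : X = 0 ∧ Y = H := by
  by_cases hX : X = 0
  · subst hX
    refine ⟨rfl, ?_⟩
    have h2 : (Y - H) * ((Y + H / 2) ^ 2 + (γ - H ^ 2 / 4)) = 0 := by linear_combination h1
    rcases mul_eq_zero.1 h2 with h | h
    · linarith
    · nlinarith [sq_nonneg (Y + H / 2)]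
  · exfalso
    -- Off the axis of symmetry the first equation fixes the common factor; the second then gives `Y
    -- * (γ - 2) = γ * H`, and no real `X` is left.
    have hM : X ^ 2 + Y ^ 2 - H ^ 2 = -2 :=
      mul_left_cancel₀ hX (by linear_combination h0)
    rw [hM] at h1
    have hXp : 0 < X ^ 2 := by positivity
    by_cases hγ2 : γ = 2
    · subst hγ2
      have : H = 0 := by linarith
      subst this
      nlinarith [sq_nonneg Y]
    · have hp : 0 < (2 - γ) ^ 2 := by
        have : 2 - γ ≠ 0 := fun h => hγ2 (by linarith)
        positivity
      have key : X ^ 2 * (2 - γ) ^ 2 = H ^ 2 * (4 - 4 * γ) - 2 * (2 - γ) ^ 2 := by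
        linear_combination (2 - γ) ^ 2 * hM + (2 * Y - γ * Y - γ * H) * h1
      have hpos := mul_pos hXp hp
      rcases le_total 1 γ with h | h
      · nlinarith [mul_nonneg (sq_nonneg H) (sub_nonneg.2 h)]
      -- Inserting `H ^ 2 ≤ 4 * γ` bounds the right side of `key` by `-2 * (3 * γ - 2) ^ 2`.
      · nlinarith [mul_nonneg (sub_nonneg.2 hH.le) (sub_nonneg.2 h), sq_nonneg (3 * γ - 2)]

theorem equilibrium_unique_of_quartic_ne_zero {γ A H X Y : ℝ}
    (hQ : ∀ y, normalizedQuartic γ A |H| y ≠ 0)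
    (h0 : X * (X ^ 2 + Y ^ 2 - A ^ 2 - H ^ 2) + 2 * (X - A) = 0)
    (h1 : Y * (X ^ 2 + Y ^ 2 - A ^ 2 - H ^ 2) + γ * (Y - H) = 0) : X = A ∧ Y = H := by
  -- The quartic is invariant under changing the signs of `H` and `Y` together, so orientation is
  -- immaterial.
  have hQ' : ∀ y, normalizedQuartic γ A H y ≠ 0 := by
    intro y
    rcases abs_choice H with h | h <;> rw [h] at hQ
    · exact hQ y
    · have := hQ (-y)
      intro h2
      apply this
      rw [← h2]; unfold normalizedQuartic; ring
  -- For a degenerate triangle `0` is always a root, so root-freeness excludes it.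
  have hH : H ≠ 0 := by
    rintro rfl
    apply hQ' 0; unfold normalizedQuartic; ring
  -- This combination cancels the common cubic factor and makes `X` rational in `Y`; substituting it
  -- into the second equation factors out `Y - H`.
  have hD : X * (γ * (H - Y) + 2 * Y) = 2 * A * Y := by
    linear_combination Y * h0 - X * h1
  have h2 : (Y - H) * normalizedQuartic γ A H Y = 0 := by
    unfold normalizedQuartic
    linear_combination (γ * (H - Y) + 2 * Y) ^ 2 * h1
      - Y * (X * (γ * (H - Y) + 2 * Y) + 2 * A * Y) * hD
  rcases mul_eq_zero.1 h2 with h | h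
  · have hY : Y = H := by linarith
    subst hY
    have hM : X ^ 2 + Y ^ 2 - A ^ 2 - Y ^ 2 = 0 :=
      mul_left_cancel₀ hH (by linear_combination h1)
    rw [hM] at h0
    exact ⟨by linarith, rfl⟩
  · exact absurd h (hQ' Y)

/-- A triangle in normalized coordinates relative to its base. -/
theorem exists_triangle_coords {a b : Plane} (hab : a ≠ b) (c : Plane) : ∃ A H : ℝ,
    (c 0 = (a 0 + b 0) / 2 + A / 2 * (b 0 - a 0) - H / 2 * (b 1 - a 1) ∧
    c 1 = (a 1 + b 1) / 2 + A / 2 * (b 1 - a 1) + H / 2 * (b 0 - a 0)) ∧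
    ‖c - b‖ ^ 2 = ‖b - a‖ ^ 2 / 4 * ((A - 1) ^ 2 + H ^ 2) ∧
    ‖c - a‖ ^ 2 = ‖b - a‖ ^ 2 / 4 * ((A + 1) ^ 2 + H ^ 2) ∧
    signedArea a b c = ‖b - a‖ ^ 2 / 4 * H := by
  obtain ⟨A, H, h0, h1⟩ := exists_base_coords hab c
  refine ⟨A, H, ⟨h0, h1⟩, ?_, ?_, ?_⟩
  · simp only [plane_norm_sq, PiLp.sub_apply, h0, h1]; ring
  · simp only [plane_norm_sq, PiLp.sub_apply, h0, h1]; ring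
  · simp only [plane_norm_sq, PiLp.sub_apply, signedArea_eq, h0, h1]; ring

theorem exists_isGainBound {a b c : Plane} (hab : a ≠ b)
    (htri : |(‖c - a‖ ^ 2 - ‖c - b‖ ^ 2) / ‖b - a‖ ^ 2| < 2 * Real.sqrt 2)
    (hS : signedArea a b c ≠ 0) (hne : ‖c - a‖ ≠ ‖c - b‖) :
    ∃ g : ℝ, IsGainBound ‖b - a‖ ‖c - b‖ ‖c - a‖ g := by
  obtain ⟨A, H, -, h2, h3, hS'⟩ := exists_triangle_coords hab c
  have hs : 0 < ‖b - a‖ := norm_pos_iff.2 (sub_ne_zero.2 hab.symm)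
  have hH : 0 < |H| := by
    rw [abs_pos]; rintro rfl; exact hS (by rw [hS', mul_zero])
  have hA0 : A ≠ 0 := by
    rintro rfl
    apply hne
    rw [← sq_eq_sq₀ (norm_nonneg _) (norm_nonneg _), h2, h3]; ring
  have hA : A ^ 2 < 8 := by
    -- The ratio in the shape hypothesis is the abscissa of the apex in normalized coordinates.
    have : (‖c - a‖ ^ 2 - ‖c - b‖ ^ 2) / ‖b - a‖ ^ 2 = A := by
      rw [h2, h3]; field_simp; ring
    rw [this] at htri
    have := sq_lt_sq' (by linarith [abs_nonneg A]) htri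
    rw [sq_abs, mul_pow, Real.sq_sqrt (by norm_num)] at this
    linarith
  have h8 : 0 < 8 - A ^ 2 := by linarith
  have hg : 0 < 2 * |H| ^ 2 / (8 - A ^ 2) := by positivity
  refine ⟨_, hg, fun γ hγ x => ?_⟩
  have := gainQuartic_eq hs h2 h3 γ (2 * x / ‖b - a‖)
  rw [show ‖b - a‖ / 2 * (2 * x / ‖b - a‖) = x by field_simp] at this
  rw [this]
  have hp := normalizedQuartic_pos hH (hg.trans hγ) hA0 hA hγ (2 * x / ‖b - a‖)
  exact mul_ne_zero (neg_ne_zero.2 (by positivity)) hp.ne'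

theorem agentField_eq_zero_iff {a b c x : Plane} {α β : ℝ} (hab : a ≠ b) (hα : 0 < α) (hβ : 0 < β)
    (hiso : ‖c - a‖ = ‖c - b‖ →
      (‖c - b‖ ^ 2 - ‖b - a‖ ^ 2 / 4) / ‖b - a‖ ^ 2 < β / α)
    (hgain : ‖c - a‖ ≠ ‖c - b‖ →
      ∃ g, IsGainBound ‖b - a‖ ‖c - b‖ ‖c - a‖ g ∧ g < β / α) :
    agentField α β ‖c - a‖ ‖c - b‖ (signedArea a b c) a b x = 0 ↔ x = c := by
  constructor
  swap
  · rintro rfl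
    simp [agentField]
  intro hF
  obtain ⟨A, H, ⟨hc0, hc1⟩, h2, h3, hS⟩ := exists_triangle_coords hab c
  obtain ⟨X, Y, ⟨hx0, hx1⟩, k2, k3, kS⟩ := exists_triangle_coords hab x
  have hs : 0 < ‖b - a‖ := norm_pos_iff.2 (sub_ne_zero.2 hab.symm)
  have hN : ‖b - a‖ ^ 2 = (b 0 - a 0) ^ 2 + (b 1 - a 1) ^ 2 := by
    simp [plane_norm_sq]
  have hF0 := agentField_apply_zero α β ‖c - a‖ ‖c - b‖ (signedArea a b c) a b x
  have hF1 := agentField_apply_one α β ‖c - a‖ ‖c - b‖ (signedArea a b c) a b x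
  rw [hF, h2, h3, k2, k3, hS, kS, PiLp.zero_apply] at hF0 hF1
  set N := ‖b - a‖ ^ 2 with hNd
  have hNp : 0 < N := by positivity
  set γ := β / α with hγ
  have hγp : 0 < γ := by positivity
  have hβ' : β = γ * α := by rw [hγ]; field_simp
  have hk : α * N ^ 2 / 4 ≠ 0 := by positivity
  have e0 : X * (X ^ 2 + Y ^ 2 - A ^ 2 - H ^ 2) + 2 * (X - A) = 0 := by
    refine (mul_eq_zero.1 (?_ : α * N ^ 2 / 4 * _ = 0)).resolve_left hk
    clear_value N γ; subst hN
    simp only [hx0, hx1, hβ'] at hF0 hF1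
    linear_combination (b 0 - a 0) * hF0 + (b 1 - a 1) * hF1
  have e1 : Y * (X ^ 2 + Y ^ 2 - A ^ 2 - H ^ 2) + γ * (Y - H) = 0 := by
    refine (mul_eq_zero.1 (?_ : α * N ^ 2 / 4 * _ = 0)).resolve_left hk
    clear_value N γ; subst hN
    simp only [hx0, hx1, hβ'] at hF0 hF1
    linear_combination (b 0 - a 0) * hF1 - (b 1 - a 1) * hF0
  have hXY : X = A ∧ Y = H := by
    by_cases hd : ‖c - a‖ = ‖c - b‖
    · have hA0 : A = 0 := by
        have : ‖c - a‖ ^ 2 = ‖c - b‖ ^ 2 := by rw [hd]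
        rw [h2, h3] at this
        have : N * A = 0 := by linear_combination this
        exact (mul_eq_zero.1 this).resolve_left hNp.ne'
      subst hA0
      have h4 := hiso hd
      rw [h2] at h4
      have h5 : H ^ 2 / 4 < γ := by
        convert h4 using 1
        field_simp; ring
      exact equilibrium_unique_isosceles h5 (by linear_combination e0)
        (by linear_combination e1)
    · obtain ⟨g, hg, hgγ⟩ := hgain hd
      refine equilibrium_unique_of_quartic_ne_zero (fun y hy => ?_) e0 e1
      apply hg.2 γ hgγ (‖b - a‖ / 2 * y)
      rw [gainQuartic_eq hs h2 h3, hy, mul_zero]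
  obtain ⟨rfl, rfl⟩ := hXY
  exact plane_ext (by rw [hx0, hc0]) (by rw [hx1, hc1])

/-! ### Inward-pointing velocity far from the origin. -/

theorem abs_cross_le (v w : Plane) : |v 0 * w 1 - v 1 * w 0| ≤ ‖v‖ * ‖w‖ := by
  apply abs_le_of_sq_le_sq _ (by positivity)
  rw [mul_pow, plane_norm_sq, plane_norm_sq]
  nlinarith [sq_nonneg (v 0 * w 0 + v 1 * w 1)]

theorem abs_signedArea_le (a b c : Plane) :
    |signedArea a b c| ≤ 1 / 2 * (‖b - a‖ * ‖c - a‖) := by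
  rw [signedArea_eq, abs_mul, abs_of_pos (by norm_num : (0 : ℝ) < 1 / 2)]
  gcongr
  exact abs_cross_le (b - a) (c - a)

theorem abs_inner_JT_le (v w : Plane) : |inner ℝ v (JT w)| ≤ ‖v‖ * ‖w‖ := by
  rw [plane_inner, JT_apply_zero, JT_apply_one, ← abs_neg]
  convert abs_cross_le v w using 2; ring

theorem inner_distance_term_ge {M d : ℝ} {x y : Plane} (hM : 0 ≤ M) (hy : ‖y‖ ≤ M)
    (hx : 2 * M + 3 * |d| ≤ ‖x‖) :
    ‖x‖ ^ 4 / 16 ≤ (‖x - y‖ ^ 2 - d ^ 2) * inner ℝ x (x - y) := by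
  have hd := abs_nonneg d
  have h1 : ‖x‖ ^ 2 / 2 ≤ inner ℝ x (x - y) := by
    rw [inner_sub_right, real_inner_self_eq_norm_sq]
    have := real_inner_le_norm x y
    nlinarith [norm_nonneg x, norm_nonneg y]
  have h2 : ‖x‖ ^ 2 / 4 ≤ ‖x - y‖ ^ 2 := by
    have : ‖x‖ / 2 ≤ ‖x - y‖ := by
      have := norm_sub_norm_le x y
      linarith
    nlinarith [norm_nonneg x]
  have h3 : d ^ 2 ≤ ‖x‖ ^ 2 / 8 := by
    rw [← sq_abs]; nlinarith
  calc ‖x‖ ^ 4 / 16 = (‖x‖ ^ 2 / 8) * (‖x‖ ^ 2 / 2) := by ring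
    _ ≤ _ := mul_le_mul (by linarith) h1 (by positivity) (by nlinarith [norm_nonneg x])

/-- Far from the origin the velocity of an agent with neighbours in a given ball does not point
outwards. -/
theorem exists_inner_agentField_nonpos {α β : ℝ} (hα : 0 < α) (hβ : 0 ≤ β) (d₁ d₂ S : ℝ) {M : ℝ}
    (hM : 0 ≤ M) : ∃ B : ℝ, 0 ≤ B ∧ ∀ y z x : Plane, ‖y‖ ≤ M → ‖z‖ ≤ M → B ≤ ‖x‖ →
      inner ℝ x (agentField α β d₁ d₂ S y z x) ≤ 0 := by
  -- Once `‖x‖ ^ 2 ≥ C`, the quartic gain `α * ‖x‖ ^ 4 / 8` from the two distance terms absorbs the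
  -- quadratic bound on the area term.
  set C := 8 * β * M * (3 * M + 2 * |S|) / α with hC
  have hC0 : 0 ≤ C := by positivity
  refine ⟨2 * M + 1 + 3 * |d₁| + 3 * |d₂| + C, by positivity, fun y z x hy hz hx => ?_⟩
  have hd1 := abs_nonneg d₁
  have hd2 := abs_nonneg d₂
  have t1 := inner_distance_term_ge (d := d₁) hM hy (by linarith : _ ≤ ‖x‖)
  have t2 := inner_distance_term_ge (d := d₂) hM hz (by linarith : _ ≤ ‖x‖)
  have hr : 1 ≤ ‖x‖ := by linarith
  have hzy : ‖z - y‖ ≤ 2 * M := (norm_sub_le _ _).trans (by linarith)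
  have hxy : ‖x - y‖ ≤ 3 / 2 * ‖x‖ := (norm_sub_le _ _).trans (by linarith)
  have t3 : |(signedArea y z x - S) * inner ℝ x (JT (z - y))|
      ≤ M * (3 * M + 2 * |S|) * ‖x‖ ^ 2 := by
    rw [abs_mul]
    have a1 : |signedArea y z x - S| ≤ (3 / 2 * M + |S|) * ‖x‖ := by
      refine (abs_sub _ _).trans ?_
      have := abs_signedArea_le y z x
      have h4 : ‖z - y‖ * ‖x - y‖ ≤ 2 * M * (3 / 2 * ‖x‖) :=
        mul_le_mul hzy hxy (norm_nonneg _) (by positivity)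
      nlinarith [abs_nonneg S]
    have a2 : |inner ℝ x (JT (z - y))| ≤ ‖x‖ * (2 * M) :=
      (abs_inner_JT_le _ _).trans (by gcongr)
    calc _ ≤ (3 / 2 * M + |S|) * ‖x‖ * (‖x‖ * (2 * M)) :=
          mul_le_mul a1 a2 (abs_nonneg _) (by positivity)
      _ = _ := by ring
  have e : inner ℝ x (agentField α β d₁ d₂ S y z x) =
      -(α * ((‖x - y‖ ^ 2 - d₁ ^ 2) * inner ℝ x (x - y)
        + (‖x - z‖ ^ 2 - d₂ ^ 2) * inner ℝ x (x - z)))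
      - β * ((signedArea y z x - S) * inner ℝ x (JT (z - y))) := by
    unfold agentField
    rw [sub_sub_sub_cancel_left, inner_sub_right, inner_neg_right, inner_smul_right,
      inner_add_right, inner_smul_right, inner_smul_right, inner_smul_right]
    ring
  rw [e]
  have h5 : α * C = 8 * β * M * (3 * M + 2 * |S|) := by rw [hC]; field_simp
  have h6 : C ≤ ‖x‖ ^ 2 := by nlinarith
  have h7 : β * (M * (3 * M + 2 * |S|) * ‖x‖ ^ 2) ≤ α * (‖x‖ ^ 4 / 8) := by
    have : α * C * ‖x‖ ^ 2 ≤ α * ‖x‖ ^ 2 * ‖x‖ ^ 2 := by gcongr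
    rw [h5] at this
    nlinarith
  have h8 := mul_le_mul_of_nonneg_left (neg_le_of_abs_le t3) hβ
  nlinarith [mul_le_mul_of_nonneg_left (add_le_add t1 t2) hα.le]

/-! ### The potential, and regularity of the velocity. -/

/-- The potential of an agent at `x` whose neighbours are at `a` and `b`. -/
def agentPotential (α β d₁ d₂ S : ℝ) (a b x : Plane) : ℝ :=
  α / 4 * ((‖x - a‖ ^ 2 - d₁ ^ 2) ^ 2 + (‖x - b‖ ^ 2 - d₂ ^ 2) ^ 2)
    + β * (signedArea a b x - S) ^ 2

theorem hasDerivWithinAt_apply {x : ℝ → Plane} {u : Plane} {s : Set ℝ} {t : ℝ}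
    (h : HasDerivWithinAt x u s t) (i : Fin 2) :
    HasDerivWithinAt (fun r => x r i) (u i) s t :=
  ((EuclideanSpace.proj i : Plane →L[ℝ] ℝ).hasFDerivAt.comp_hasDerivWithinAt t h)

/-- `agentField` is minus the gradient of the potential with the neighbours frozen at `a`, `b`. The
velocity `u` is left arbitrary because the true one comes from moving neighbours. -/
theorem hasDerivWithinAt_agentPotential {x : ℝ → Plane} {u : Plane} {s : Set ℝ} {t : ℝ}
    (h : HasDerivWithinAt x u s t) (α β d₁ d₂ S : ℝ) (a b : Plane) :
    HasDerivWithinAt (fun r => agentPotential α β d₁ d₂ S a b (x r))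
      (-inner ℝ (agentField α β d₁ d₂ S a b (x t)) u) s t := by
  have h0 := hasDerivWithinAt_apply h 0
  have h1 := hasDerivWithinAt_apply h 1
  have hz : ∀ (c : Plane) (d : ℝ), HasDerivWithinAt (fun r => (‖x r - c‖ ^ 2 - d ^ 2) ^ 2)
      (4 * (‖x t - c‖ ^ 2 - d ^ 2) * ((x t 0 - c 0) * u 0 + (x t 1 - c 1) * u 1)) s t := by
    intro c d
    simp only [plane_norm_sq, PiLp.sub_apply]
    refine HasDerivWithinAt.congr_deriv (((((h0.sub_const (c 0)).fun_pow 2).fun_add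
      ((h1.sub_const (c 1)).fun_pow 2)).sub_const (d ^ 2)).fun_pow 2) ?_
    simp; ring
  have hS : HasDerivWithinAt (fun r => (signedArea a b (x r) - S) ^ 2)
      ((signedArea a b (x t) - S) * ((b 0 - a 0) * u 1 - (b 1 - a 1) * u 0)) s t := by
    simp only [signedArea_eq]
    refine HasDerivWithinAt.congr_deriv ((((((h1.sub_const (a 1)).const_mul (b 0 - a 0)).fun_sub
      ((h0.sub_const (a 0)).const_mul (b 1 - a 1))).const_mul (1 / 2)).sub_const S).fun_pow 2) ?_
    simp; ring
  unfold agentPotential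
  refine HasDerivWithinAt.congr_deriv
    ((((hz a d₁).fun_add (hz b d₂)).const_mul (α / 4)).fun_add (hS.const_mul β)) ?_
  rw [plane_inner, agentField_apply_zero, agentField_apply_one]
  ring

theorem contDiff_signedArea {E : Type*} [NormedAddCommGroup E] [NormedSpace ℝ E]
    {f g h : E → Plane} (hf : ContDiff ℝ 1 f) (hg : ContDiff ℝ 1 g) (hh : ContDiff ℝ 1 h) :
    ContDiff ℝ 1 (fun p => signedArea (f p) (g p) (h p)) := by
  have key : ∀ {φ : E → Plane} (_ : ContDiff ℝ 1 φ) (i : Fin 2), ContDiff ℝ 1 (fun p => φ p i) :=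
    fun hφ i => (EuclideanSpace.proj i : Plane →L[ℝ] ℝ).contDiff.comp hφ
  have f0 := key hf 0
  have f1 := key hf 1
  have g0 := key hg 0
  have g1 := key hg 1
  have h0 := key hh 0
  have h1 := key hh 1
  simp only [signedArea_eq]
  fun_prop

/-- `JT` as a continuous linear map. -/
def JTL : Plane →L[ℝ] Plane :=
  LinearMap.toContinuousLinearMap
    { toFun := JT
      map_add' := fun v w => by
        apply plane_ext <;> simp [JT_apply_zero, JT_apply_one]; ring
      map_smul' := fun c v => by
        apply plane_ext <;> simp [JT_apply_zero, JT_apply_one] }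

theorem JTL_apply (v : Plane) : JTL v = JT v := rfl

theorem contDiff_agentField {E : Type*} [NormedAddCommGroup E] [NormedSpace ℝ E]
    {f g h : E → Plane} (hf : ContDiff ℝ 1 f) (hg : ContDiff ℝ 1 g) (hh : ContDiff ℝ 1 h)
    (α β d₁ d₂ S : ℝ) : ContDiff ℝ 1 (fun p => agentField α β d₁ d₂ S (f p) (g p) (h p)) := by
  have hS := contDiff_signedArea hf hg hh
  have n1 := (hh.sub hf).norm_sq ℝ
  have n2 := (hh.sub hg).norm_sq ℝ
  unfold agentField
  simp only [← JTL_apply]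
  fun_prop

theorem continuous_agentField (α β d₁ d₂ S : ℝ) :
    Continuous (fun p : Plane × Plane × Plane => agentField α β d₁ d₂ S p.1 p.2.1 p.2.2) :=
  (contDiff_agentField (by fun_prop) (by fun_prop) (by fun_prop) α β d₁ d₂ S).continuous

theorem continuous_agentPotential (α β d₁ d₂ S : ℝ) (a b : Plane) :
    Continuous (agentPotential α β d₁ d₂ S a b) := by
  have hS : Continuous fun x => signedArea a b x :=
    (contDiff_signedArea contDiff_const contDiff_const contDiff_id).continuous
  unfold agentPotential
  fun_prop

/-! ### Differential inequalities and compactness. -/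

/-- The derivative bound is not strict, so `f` is compared with slowly rising lines of slope `δ`
above `B`, which it cannot cross; then `δ → 0`. -/
theorem le_of_deriv_nonpos_above {f f' : ℝ → ℝ} {B T : ℝ}
    (hf : ∀ t, T ≤ t → HasDerivWithinAt f (f' t) (Set.Ici T) t)
    (h : ∀ t, T ≤ t → B ≤ f t → f' t ≤ 0) (h0 : f T ≤ B) : ∀ t, T ≤ t → f t ≤ B := by
  intro t ht
  have key : ∀ δ > 0, f t ≤ B + δ * (1 + (t - T)) := by
    intro δ hδ
    refine image_le_of_deriv_right_lt_deriv_boundary (f := f) (f' := f') (a := T) (b := t)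
      (B := fun s => B + δ * (1 + (s - T))) (B' := fun _ => δ)
      (fun s hs => ((hf s hs.1).continuousWithinAt).mono (fun r hr => hr.1))
      (fun s hs => (hf s hs.1).mono (fun r hr => hs.1.trans hr)) ?_ ?_ ?_ ⟨ht, le_rfl⟩
    · simp only [sub_self, add_zero, mul_one]; linarith
    · intro s
      refine ((((hasDerivAt_id s).sub_const T).const_add 1).const_mul δ).const_add B
        |>.congr_deriv ?_
      simp
    · intro s hs hfs
      refine (h s hs.1 ?_).trans_lt hδ
      rw [hfs]
      have : 0 ≤ s - T := sub_nonneg.2 hs.1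
      nlinarith
  have hlim : Tendsto (fun δ : ℝ => B + δ * (1 + (t - T))) (𝓝[>] 0) (𝓝 B) := by
    have : Continuous fun δ : ℝ => B + δ * (1 + (t - T)) := by fun_prop
    simpa using (this.tendsto 0).mono_left nhdsWithin_le_nhds
  exact ge_of_tendsto hlim (eventually_mem_nhdsWithin.mono fun δ hδ => key δ hδ)

/-- Staying above `ε` forever would drive `v` below zero at rate `c`; once below `ε` late enough, it
cannot climb back. Early increase is allowed, as happens while the neighbours are still moving. -/
theorem tendsto_zero_of_deriv_neg {v v' : ℝ → ℝ}
    (hv : ∀ t, 0 ≤ t → HasDerivWithinAt v (v' t) (Set.Ici 0) t) (hnn : ∀ t, 0 ≤ v t)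
    (h : ∀ ε > 0, ∃ c > 0, ∀ᶠ t in atTop, ε ≤ v t → v' t ≤ -c) :
    Tendsto v atTop (𝓝 0) := by
  have main : ∀ ε > 0, ∀ᶠ t in atTop, v t ≤ ε := by
    intro ε hε
    obtain ⟨c, hc, hev⟩ := h ε hε
    obtain ⟨T, hT⟩ := eventually_atTop.1 (hev.and (eventually_ge_atTop 0))
    have hT0 : 0 ≤ T := (hT T le_rfl).2
    have hvT : ∀ s, 0 ≤ s → ∀ t, s ≤ t → HasDerivWithinAt v (v' t) (Set.Ici s) t :=
      fun s hs t ht => (hv t (hs.trans ht)).mono (Set.Ici_subset_Ici.2 hs)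
    have hex : ∃ t₁, T ≤ t₁ ∧ v t₁ ≤ ε := by
      by_contra! hcon
      have hg : ∀ t, T ≤ t → v t + c * (t - T) ≤ v T := by
        refine le_of_deriv_nonpos_above (f' := fun t => v' t + c) (fun t ht => ?_)
          (fun t ht _ => ?_) (by simp)
        · refine (hvT T hT0 t ht).fun_add (HasDerivAt.hasDerivWithinAt ?_)
          refine (((hasDerivAt_id t).sub_const T).const_mul c).congr_deriv (by simp)
        · have := (hT t ht).1 (hcon t ht).le
          linarith
      have h1 := hg (T + (v T / c + 1)) (by have := hnn T; have : 0 ≤ v T / c := by positivity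
                                            linarith)
      have h2 := hnn (T + (v T / c + 1))
      have h3 : c * (T + (v T / c + 1) - T) = v T + c := by field_simp; ring
      linarith
    obtain ⟨t₁, ht₁, hvt₁⟩ := hex
    refine eventually_atTop.2 ⟨t₁, le_of_deriv_nonpos_above (hvT t₁ (hT0.trans ht₁))
      (fun t ht hle => ?_) hvt₁⟩
    have := (hT t (ht₁.trans ht)).1 hle
    linarith
  rw [Metric.tendsto_nhds]
  intro ε hε
  filter_upwards [main (ε / 2) (by positivity)] with t ht
  rw [Real.dist_eq, sub_zero, abs_of_nonneg (hnn t)]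
  linarith

/-- On the compact part of `K` where `V ≥ ε`, the function at `θ₀` has a negative maximum; half of
it survives for nearby parameters by the tube lemma. -/
theorem exists_uniform_decay {E P : Type*} [TopologicalSpace E] [TopologicalSpace P]
    {K : Set E} (hK : IsCompact K) {Φ : P × E → ℝ} (hΦ : Continuous Φ) {V : E → ℝ}
    (hV : Continuous V) {θ₀ : P} (hneg : ∀ x, 0 < V x → Φ (θ₀, x) < 0) {ε : ℝ} (hε : 0 < ε) :
    ∃ c > 0, ∀ᶠ θ in 𝓝 θ₀, ∀ x ∈ K, ε ≤ V x → Φ (θ, x) ≤ -c := by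
  have hK' : IsCompact (K ∩ {x | ε ≤ V x}) :=
    hK.inter_right (isClosed_le continuous_const hV)
  rcases (K ∩ {x | ε ≤ V x}).eq_empty_or_nonempty with he | hne
  · refine ⟨1, one_pos, Eventually.of_forall fun θ x hx hVx => ?_⟩
    exact absurd (show x ∈ K ∩ {x | ε ≤ V x} from ⟨hx, hVx⟩) (by simp [he])
  obtain ⟨x₀, hx₀, hmax⟩ := hK'.exists_isMaxOn hne
    (f := fun x => Φ (θ₀, x)) (by fun_prop : Continuous fun x => Φ (θ₀, x)).continuousOn
  have h0 : Φ (θ₀, x₀) < 0 := hneg x₀ (hε.trans_le hx₀.2)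
  refine ⟨-(Φ (θ₀, x₀)) / 2, by linarith, ?_⟩
  have := hK'.eventually_forall_of_forall_eventually (x₀ := θ₀)
    (P := fun θ x => Φ (θ, x) ≤ -(-(Φ (θ₀, x₀)) / 2)) ?_
  · filter_upwards [this] with θ hθ x hx hVx using hθ x ⟨hx, hVx⟩
  · intro x hx
    have h1 : Φ (θ₀, x) < -(-(Φ (θ₀, x₀)) / 2) := by
      have : Φ (θ₀, x) ≤ Φ (θ₀, x₀) := hmax hx
      linarith
    exact (hΦ.continuousAt.eventually_lt continuousAt_const h1).mono fun z hz => hz.le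

theorem exists_dist_lt_of_lt {E : Type*} [PseudoMetricSpace E] {K : Set E} (hK : IsCompact K)
    {V : E → ℝ} (hV : Continuous V) {c : E} (hpos : ∀ x, x ≠ c → 0 < V x) {ε : ℝ} (hε : 0 < ε) :
    ∃ η > 0, ∀ x ∈ K, V x < η → dist x c < ε := by
  have hK' : IsCompact (K ∩ {x | ε ≤ dist x c}) :=
    hK.inter_right (isClosed_le continuous_const (by fun_prop))
  rcases (K ∩ {x | ε ≤ dist x c}).eq_empty_or_nonempty with he | hne
  · refine ⟨1, one_pos, fun x hx _ => ?_⟩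
    by_contra! h
    exact absurd (show x ∈ K ∩ {x | ε ≤ dist x c} from ⟨hx, h⟩) (by simp [he])
  obtain ⟨x₀, hx₀, hmin⟩ := hK'.exists_isMinOn hne hV.continuousOn
  refine ⟨V x₀, hpos x₀ ?_, fun x hx hVx => ?_⟩
  · rintro rfl
    have := hx₀.2
    simp only [Set.mem_ofPred_eq, dist_self] at this
    linarith
  · by_contra! h
    exact absurd (hmin ⟨hx, h⟩) (not_le.2 hVx)

theorem norm_le_of_inner_nonpos {E : Type*} [NormedAddCommGroup E] [InnerProductSpace ℝ E]
    {x u : ℝ → E} {B : ℝ} (hx : ∀ t, 0 ≤ t → HasDerivWithinAt x (u t) (Set.Ici 0) t)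
    (hB : ∀ t, 0 ≤ t → B ≤ ‖x t‖ → inner ℝ (x t) (u t) ≤ 0) (h0 : ‖x 0‖ ≤ B) :
    ∀ t, 0 ≤ t → ‖x t‖ ≤ B := by
  have hB0 : 0 ≤ B := (norm_nonneg _).trans h0
  intro t ht
  have := le_of_deriv_nonpos_above (f := fun t => ‖x t‖ ^ 2) (B := B ^ 2)
    (fun s hs => (hx s hs).norm_sq) (fun s hs hle => ?_) (by gcongr) t ht
  · exact (sq_le_sq₀ (norm_nonneg _) hB0).1 this
  · have := hB s hs ((sq_le_sq₀ hB0 (norm_nonneg _)).1 hle)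
    linarith

theorem agentPotential_nonneg {α β : ℝ} (hα : 0 ≤ α) (hβ : 0 ≤ β) (d₁ d₂ S : ℝ) (a b x : Plane) :
    0 ≤ agentPotential α β d₁ d₂ S a b x := by
  unfold agentPotential; positivity

/-- All three errors vanish with the potential. Thus uniqueness of the rest point also yields
uniqueness of the zero of the potential. -/
theorem agentField_eq_zero_of_potential {α β : ℝ} (hα : 0 < α) (hβ : 0 < β) {d₁ d₂ S : ℝ}
    {a b x : Plane} (h : agentPotential α β d₁ d₂ S a b x = 0) :
    agentField α β d₁ d₂ S a b x = 0 := by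
  unfold agentPotential at h
  have h1 : (‖x - a‖ ^ 2 - d₁ ^ 2) ^ 2 = 0 := by
    refine (sq_nonneg _).antisymm' ?_
    by_contra! hc
    have : 0 < α / 4 * ((‖x - a‖ ^ 2 - d₁ ^ 2) ^ 2 + (‖x - b‖ ^ 2 - d₂ ^ 2) ^ 2) := by positivity
    nlinarith [mul_nonneg hβ.le (sq_nonneg (signedArea a b x - S))]
  have h2 : (‖x - b‖ ^ 2 - d₂ ^ 2) ^ 2 = 0 := by
    refine (sq_nonneg _).antisymm' ?_
    by_contra! hc
    have : 0 < α / 4 * ((‖x - a‖ ^ 2 - d₁ ^ 2) ^ 2 + (‖x - b‖ ^ 2 - d₂ ^ 2) ^ 2) := by positivity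
    nlinarith [mul_nonneg hβ.le (sq_nonneg (signedArea a b x - S))]
  rw [h1, h2, add_zero, mul_zero, zero_add] at h
  have h3 := (mul_eq_zero.1 h).resolve_left hβ.ne'
  rw [sq_eq_zero_iff] at h1 h2 h3
  simp [agentField, h1, h2, h3]

/-! ### Convergence and stability of one agent with moving neighbours. -/

/-- The target `c` of an agent with neighbours at `a` and `b` is the only rest point. -/
structure IsAgentTarget (α β : ℝ) (a b c : Plane) : Prop where
  pos_left : 0 < α
  pos_right : 0 < β
  base_ne : a ≠ b
  rest : ∀ x, agentField α β ‖c - a‖ ‖c - b‖ (signedArea a b c) a b x = 0 ↔ x = c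

namespace IsAgentTarget

variable {α β : ℝ} {a b c : Plane}

theorem potential_pos (h : IsAgentTarget α β a b c) {x : Plane} (hx : x ≠ c) :
    0 < agentPotential α β ‖c - a‖ ‖c - b‖ (signedArea a b c) a b x := by
  refine lt_of_le_of_ne (agentPotential_nonneg h.pos_left.le h.pos_right.le _ _ _ _ _ _) ?_
  intro h0
  exact hx ((h.rest x).1 (agentField_eq_zero_of_potential h.pos_left h.pos_right h0.symm))

theorem potential_target : agentPotential α β ‖c - a‖ ‖c - b‖ (signedArea a b c) a b c = 0 := by
  simp [agentPotential]

/-- The rate of change of the potential at `x` when the neighbours are at `θ`. -/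
def rate (α β : ℝ) (a b c : Plane) (p : (Plane × Plane) × Plane) : ℝ :=
  -inner ℝ (agentField α β ‖c - a‖ ‖c - b‖ (signedArea a b c) a b p.2)
    (agentField α β ‖c - a‖ ‖c - b‖ (signedArea a b c) p.1.1 p.1.2 p.2)

theorem continuous_rate : Continuous (rate α β a b c) := by
  have h1 := (continuous_agentField α β ‖c - a‖ ‖c - b‖ (signedArea a b c)).comp
    (by fun_prop : Continuous fun p : (Plane × Plane) × Plane => (a, b, p.2))
  have h2 := (continuous_agentField α β ‖c - a‖ ‖c - b‖ (signedArea a b c)).comp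
    (by fun_prop : Continuous fun p : (Plane × Plane) × Plane => (p.1.1, p.1.2, p.2))
  exact (h1.inner h2).neg

theorem rate_neg (h : IsAgentTarget α β a b c) {x : Plane}
    (hx : 0 < agentPotential α β ‖c - a‖ ‖c - b‖ (signedArea a b c) a b x) :
    rate α β a b c ((a, b), x) < 0 := by
  unfold rate
  rw [real_inner_self_eq_norm_sq, neg_lt_zero]
  have : agentField α β ‖c - a‖ ‖c - b‖ (signedArea a b c) a b x ≠ 0 := by
    intro h0
    rw [(h.rest x).1 h0, potential_target] at hx
    exact lt_irrefl _ hx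
  positivity

theorem exists_decay (h : IsAgentTarget α β a b c) (B : ℝ) {ε : ℝ} (hε : 0 < ε) :
    ∃ r > 0, ∀ᶠ θ in 𝓝 (a, b), ∀ x ∈ Metric.closedBall (0 : Plane) B,
      ε ≤ agentPotential α β ‖c - a‖ ‖c - b‖ (signedArea a b c) a b x →
      rate α β a b c (θ, x) ≤ -r :=
  exists_uniform_decay (isCompact_closedBall _ _) continuous_rate
    (continuous_agentPotential _ _ _ _ _ _ _) (fun _ hx => h.rate_neg hx) hε

variable {x y z : ℝ → Plane}

theorem bounded_and_tendsto (h : IsAgentTarget α β a b c)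
    (hx : ∀ t, 0 ≤ t → HasDerivWithinAt x
      (agentField α β ‖c - a‖ ‖c - b‖ (signedArea a b c) (y t) (z t) (x t)) (Set.Ici 0) t)
    (hyb : ∃ M, ∀ t, 0 ≤ t → ‖y t‖ ≤ M) (hzb : ∃ M, ∀ t, 0 ≤ t → ‖z t‖ ≤ M)
    (hy : Tendsto y atTop (𝓝 a)) (hz : Tendsto z atTop (𝓝 b)) :
    (∃ M, ∀ t, 0 ≤ t → ‖x t‖ ≤ M) ∧ Tendsto x atTop (𝓝 c) := by
  obtain ⟨M₁, hM₁⟩ := hyb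
  obtain ⟨M₂, hM₂⟩ := hzb
  have hM0 : 0 ≤ M₁ := (norm_nonneg _).trans (hM₁ 0 le_rfl)
  obtain ⟨B, -, hB⟩ := exists_inner_agentField_nonpos h.pos_left h.pos_right.le ‖c - a‖ ‖c - b‖
    (signedArea a b c) (hM0.trans (le_max_left M₁ M₂))
  have hxb : ∀ t, 0 ≤ t → ‖x t‖ ≤ max B ‖x 0‖ :=
    norm_le_of_inner_nonpos hx (fun t ht hle => hB _ _ _ ((hM₁ t ht).trans (le_max_left _ _))
      ((hM₂ t ht).trans (le_max_right _ _)) ((le_max_left _ _).trans hle)) (le_max_right _ _)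
  refine ⟨⟨_, hxb⟩, ?_⟩
  have hV0 := tendsto_zero_of_deriv_neg
    (fun t ht => hasDerivWithinAt_agentPotential (hx t ht) α β ‖c - a‖ ‖c - b‖
      (signedArea a b c) a b)
    (fun t => agentPotential_nonneg h.pos_left.le h.pos_right.le _ _ _ _ _ _)
    (fun ε hε => by
      obtain ⟨r, hr, hev⟩ := h.exists_decay (max B ‖x 0‖) hε
      refine ⟨r, hr, ?_⟩
      filter_upwards [(hy.prodMk_nhds hz).eventually hev, eventually_ge_atTop 0] with t ht ht0 hle
      exact ht (x t) (by simpa using hxb t ht0) hle)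
  rw [Metric.tendsto_nhds]
  intro ε hε
  obtain ⟨η, hη, hlt⟩ := exists_dist_lt_of_lt (isCompact_closedBall (0 : Plane) (max B ‖x 0‖))
    (continuous_agentPotential α β ‖c - a‖ ‖c - b‖ (signedArea a b c) a b)
    (fun _ hx => h.potential_pos hx) hε
  filter_upwards [hV0.eventually (gt_mem_nhds hη), eventually_ge_atTop 0] with t ht ht0
  exact hlt _ (by simpa using hxb t ht0) ht

/-- A sublevel set of the frozen potential inside the `ε`-ball traps the agent: for neighbours close
to `a`, `b`, the potential decreases wherever it is at least `η / 2` on the bounded region. One `δ`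
serves all motions. -/
theorem stable (h : IsAgentTarget α β a b c) {ε : ℝ} (hε : 0 < ε) :
    ∃ δ > 0, ∀ x y z : ℝ → Plane,
      (∀ t, 0 ≤ t → HasDerivWithinAt x
        (agentField α β ‖c - a‖ ‖c - b‖ (signedArea a b c) (y t) (z t) (x t)) (Set.Ici 0) t) →
      (∀ t, 0 ≤ t → dist (y t) a < δ) → (∀ t, 0 ≤ t → dist (z t) b < δ) → dist (x 0) c < δ →
      ∀ t, 0 ≤ t → dist (x t) c < ε := by
  obtain ⟨B, -, hB⟩ := exists_inner_agentField_nonpos h.pos_left h.pos_right.le ‖c - a‖ ‖c - b‖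
    (signedArea a b c) (by positivity : 0 ≤ ‖a‖ + ‖b‖ + 1)
  set B' := max B (‖c‖ + 1)
  obtain ⟨η, hη, hlt⟩ := exists_dist_lt_of_lt (isCompact_closedBall (0 : Plane) B')
    (continuous_agentPotential α β ‖c - a‖ ‖c - b‖ (signedArea a b c) a b)
    (fun _ hx => h.potential_pos hx) hε
  obtain ⟨r, hr, hev⟩ := h.exists_decay B' (half_pos hη)
  obtain ⟨δ₁, hδ₁, hθ⟩ := Metric.eventually_nhds_iff.1 hev
  have hVc := (continuous_agentPotential α β ‖c - a‖ ‖c - b‖ (signedArea a b c) a b).tendsto c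
  rw [potential_target] at hVc
  obtain ⟨δ₂, hδ₂, hVδ⟩ := Metric.eventually_nhds_iff.1
    (hVc.eventually (gt_mem_nhds (half_pos hη)))
  refine ⟨min 1 (min δ₁ δ₂), by positivity, fun x y z hx hy hz hx0 => ?_⟩
  have bound : ∀ {v w : Plane}, dist v w < min 1 (min δ₁ δ₂) → ‖v‖ ≤ ‖w‖ + 1 := by
    intro v w hvw
    have h1 := hvw.trans_le (min_le_left _ _)
    rw [dist_eq_norm] at h1
    have := norm_sub_norm_le v w
    linarith
  have hxb : ∀ t, 0 ≤ t → ‖x t‖ ≤ B' := by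
    refine norm_le_of_inner_nonpos hx (fun t ht hle => hB _ _ _ ?_ ?_
      ((le_max_left _ _).trans hle)) ((bound hx0).trans (le_max_right _ _))
    · exact (bound (hy t ht)).trans (by linarith [norm_nonneg b])
    · exact (bound (hz t ht)).trans (by linarith [norm_nonneg a])
  intro t ht
  refine hlt _ (by simpa using hxb t ht) (lt_of_le_of_lt ?_ (half_lt_self hη))
  refine le_of_deriv_nonpos_above
    (fun t ht => hasDerivWithinAt_agentPotential (hx t ht) α β ‖c - a‖ ‖c - b‖
      (signedArea a b c) a b) (fun s hs hle => ?_)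
    (hVδ (hx0.trans_le ((min_le_right _ _).trans (min_le_right _ _)))).le t ht
  refine (hθ (y := (y s, z s)) ?_ (x s) (by simpa using hxb s hs) hle).trans (by linarith)
  rw [Prod.dist_eq]
  exact max_lt ((hy s hs).trans_le ((min_le_right _ _).trans (min_le_left _ _)))
    ((hz s hs).trans_le ((min_le_right _ _).trans (min_le_left _ _)))

end IsAgentTarget

/-- The difference of squared distances gives the coordinate along the base and the signed area the
one across it. So the apex is a continuous function `G` of the base points, squared distances and
area, as long as the base points differ. -/
theorem exists_dist_lt_of_errors {a b c : Plane} (hab : a ≠ b) {ε : ℝ} (hε : 0 < ε) :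
    ∃ δ > 0, ∀ y z x : Plane, dist y a < δ → dist z b < δ →
      |‖x - y‖ ^ 2 - ‖c - a‖ ^ 2| < δ → |‖x - z‖ ^ 2 - ‖c - b‖ ^ 2| < δ →
      |signedArea y z x - signedArea a b c| < δ → dist x c < ε := by
  set G : Plane × Plane × ℝ × ℝ × ℝ → Plane := fun p =>
    (1 / 2 : ℝ) • (p.1 + p.2.1)
      + ((p.2.2.1 - p.2.2.2.1) / (2 * ‖p.2.1 - p.1‖ ^ 2)) • (p.2.1 - p.1)
      + (2 * p.2.2.2.2 / ‖p.2.1 - p.1‖ ^ 2) • JTL (p.2.1 - p.1) with hG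
  have recon : ∀ y z x : Plane, y ≠ z →
      G (y, z, ‖x - y‖ ^ 2, ‖x - z‖ ^ 2, signedArea y z x) = x := by
    intro y z x hyz
    obtain ⟨X, Y, ⟨h0, h1⟩, h2, h3, h4⟩ := exists_triangle_coords hyz x
    have hs : 0 < ‖z - y‖ := norm_pos_iff.2 (sub_ne_zero.2 hyz.symm)
    have e1 : (‖x - y‖ ^ 2 - ‖x - z‖ ^ 2) / (2 * ‖z - y‖ ^ 2) = X / 2 := by
      rw [h2, h3]; field_simp; ring
    have e2 : 2 * signedArea y z x / ‖z - y‖ ^ 2 = Y / 2 := by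
      rw [h4]; field_simp; ring
    simp only [hG, e1, e2, JTL_apply]
    apply plane_ext
    · simp [JT_apply_zero, h0]; ring
    · simp [JT_apply_one, h1]; ring
  have hN : ‖b - a‖ ^ 2 ≠ 0 := by
    have : b - a ≠ 0 := sub_ne_zero.2 hab.symm
    positivity
  have hcont : ContinuousAt G (a, b, ‖c - a‖ ^ 2, ‖c - b‖ ^ 2, signedArea a b c) := by
    have hN2 : 2 * ‖b - a‖ ^ 2 ≠ 0 := mul_ne_zero two_ne_zero hN
    simp only [hG]
    fun_prop (disch := assumption)
  obtain ⟨δ₁, hδ₁, hGδ⟩ := Metric.continuousAt_iff.1 hcont ε hε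
  have hd : 0 < dist a b := dist_pos.2 hab
  refine ⟨min δ₁ (dist a b / 2), by positivity, fun y z x hy hz h1 h2 h3 => ?_⟩
  have hyz : y ≠ z := by
    rintro rfl
    have := dist_triangle_left a b y
    have h4 := hy.trans_le (min_le_right _ _)
    have h5 := hz.trans_le (min_le_right _ _)
    linarith
  have := @hGδ (y, z, ‖x - y‖ ^ 2, ‖x - z‖ ^ 2, signedArea y z x) ?_
  · rwa [recon y z x hyz, recon a b c hab] at this
  · simp only [Prod.dist_eq, Real.dist_eq]
    have := min_le_left δ₁ (dist a b / 2)
    refine max_lt (hy.trans_le this) (max_lt (hz.trans_le this) (max_lt (h1.trans_le this)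
      (max_lt (h2.trans_le this) (h3.trans_le this))))

/-! ### The first follower -/

theorem exists_pos_smul_of_linear_ode {E : Type*} [NormedAddCommGroup E] [NormedSpace ℝ E]
    {e : ℝ → E} {c : ℝ → ℝ} (hc : ContinuousOn c (Set.Ici 0))
    (he : ∀ t, 0 ≤ t → HasDerivWithinAt e (c t • e t) (Set.Ici 0) t) {t : ℝ} (ht : 0 ≤ t) :
    ∃ μ : ℝ, 0 < μ ∧ e t = μ • e 0 := by
  -- Constant extension to negative times, so that the primitive used as integrating factor has a
  -- two-sided derivative.
  set c' : ℝ → ℝ := fun s => c (max s 0)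
  have hc' : Continuous c' :=
    hc.comp_continuous (by fun_prop) (fun s => le_max_right s 0)
  set C : ℝ → ℝ := fun s => ∫ r in (0 : ℝ)..s, c' r
  have hC : ∀ s, HasDerivAt C (c' s) s := fun s =>
    intervalIntegral.integral_hasDerivAt_right (hc'.intervalIntegrable _ _)
      hc'.stronglyMeasurable.stronglyMeasurableAtFilter hc'.continuousAt
  have hg : ∀ s, 0 ≤ s →
      HasDerivWithinAt (fun s => Real.exp (-C s) • e s) 0 (Set.Ici 0) s := by
    intro s hs
    have h1 := (hC s).fun_neg.exp.hasDerivWithinAt (s := Set.Ici 0)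
    refine (h1.fun_smul (he s hs)).congr_deriv ?_
    have : c' s = c s := by simp [c', hs]
    rw [this, smul_smul, ← add_smul]
    convert zero_smul ℝ (e s) using 2
    ring
  have hconst := constant_of_has_deriv_right_zero (f := fun s => Real.exp (-C s) • e s)
    (a := 0) (b := t) (fun s hs => (hg s hs.1).continuousWithinAt.mono fun r hr => hr.1)
    (fun s hs => (hg s hs.1).mono fun r hr => hs.1.trans hr) t ⟨ht, le_rfl⟩
  refine ⟨Real.exp (C t), Real.exp_pos _, ?_⟩
  have hC0 : C 0 = 0 := by simp [C]
  simp only [hC0, neg_zero, Real.exp_zero, one_smul] at hconst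
  rw [← hconst, smul_smul, ← Real.exp_add, add_neg_cancel, Real.exp_zero, one_smul]

/-- `e` is the displacement from the leader of a first follower with desired displacement `f`, starting
in the direction of `f`. -/
structure IsFirstFollower (α : ℝ) (f : Plane) (e : ℝ → Plane) : Prop where
  deriv : ∀ t, 0 ≤ t →
    HasDerivWithinAt e (-((α * (‖e t‖ ^ 2 - ‖f‖ ^ 2)) • e t)) (Set.Ici 0) t
  init : ∃ l : ℝ, 0 < l ∧ e 0 = l • f

namespace IsFirstFollower

variable {α : ℝ} {f : Plane} {e : ℝ → Plane}

theorem exists_pos_smul (h : IsFirstFollower α f e) {t : ℝ} (ht : 0 ≤ t) :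
    ∃ l : ℝ, 0 < l ∧ e t = l • f := by
  have hcont : ContinuousOn e (Set.Ici 0) := fun t ht => (h.deriv t ht).continuousWithinAt
  obtain ⟨μ, hμ, he⟩ := exists_pos_smul_of_linear_ode
    (c := fun t => -(α * (‖e t‖ ^ 2 - ‖f‖ ^ 2))) (by fun_prop)
    (fun t ht => (h.deriv t ht).congr_deriv (neg_smul _ _).symm) ht
  obtain ⟨l, hl, h0⟩ := h.init
  exact ⟨μ * l, mul_pos hμ hl, by rw [he, h0, smul_smul]⟩

/-- On the ray `e t = l • f` with `l > 0` one has `|l - 1| ≤ |l ^ 2 - 1|`, so the length error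
controls the displacement. -/
theorem dist_le (h : IsFirstFollower α f e) (hf : f ≠ 0) {t : ℝ} (ht : 0 ≤ t) :
    dist (e t) f ≤ |‖e t‖ ^ 2 - ‖f‖ ^ 2| / ‖f‖ := by
  obtain ⟨l, hl, he⟩ := h.exists_pos_smul ht
  have hf' : 0 < ‖f‖ := norm_pos_iff.2 hf
  have h1 : dist (e t) f = |l - 1| * ‖f‖ := by
    rw [dist_eq_norm, he, ← Real.norm_eq_abs, ← norm_smul, sub_smul, one_smul]
  have h2 : ‖e t‖ ^ 2 - ‖f‖ ^ 2 = (l - 1) * (l + 1) * ‖f‖ ^ 2 := by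
    rw [he, norm_smul, Real.norm_eq_abs, abs_of_pos hl]; ring
  rw [h1, h2, le_div_iff₀ hf', abs_mul, abs_mul, abs_of_pos (by positivity : 0 < l + 1),
    abs_of_pos (by positivity : 0 < ‖f‖ ^ 2)]
  have : 0 ≤ |l - 1| * ‖f‖ ^ 2 := by positivity
  nlinarith

theorem hasDeriv_sq (h : IsFirstFollower α f e) (t : ℝ) (ht : 0 ≤ t) :
    HasDerivWithinAt (fun s => ‖e s‖ ^ 2)
      (-(2 * α * (‖e t‖ ^ 2 - ‖f‖ ^ 2) * ‖e t‖ ^ 2)) (Set.Ici 0) t := by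
  refine (h.deriv t ht).norm_sq.congr_deriv ?_
  rw [inner_neg_right, inner_smul_right, real_inner_self_eq_norm_sq]; ring

theorem hasDeriv_err (h : IsFirstFollower α f e) (t : ℝ) (ht : 0 ≤ t) :
    HasDerivWithinAt (fun s => (‖e s‖ ^ 2 - ‖f‖ ^ 2) ^ 2)
      (-(4 * α * ‖e t‖ ^ 2 * (‖e t‖ ^ 2 - ‖f‖ ^ 2) ^ 2)) (Set.Ici 0) t := by
  refine (((h.hasDeriv_sq t ht).sub_const (‖f‖ ^ 2)).fun_pow 2).congr_deriv ?_
  simp; ring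

theorem err_le (h : IsFirstFollower α f e) (hα : 0 < α) {t : ℝ} (ht : 0 ≤ t) :
    |‖e t‖ ^ 2 - ‖f‖ ^ 2| ≤ |‖e 0‖ ^ 2 - ‖f‖ ^ 2| :=
  sq_le_sq.1 (le_of_deriv_nonpos_above h.hasDeriv_err
    (fun s _ _ => neg_nonpos.2 (by positivity)) le_rfl t ht)

theorem tendsto (h : IsFirstFollower α f e) (hα : 0 < α) (hf : f ≠ 0) :
    Tendsto e atTop (𝓝 f) := by
  have hf' : 0 < ‖f‖ := norm_pos_iff.2 hf
  obtain ⟨l, hl, he0⟩ := h.init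
  have he0' : 0 < ‖e 0‖ := by rw [he0, norm_smul, Real.norm_of_nonneg hl.le]; positivity
  -- The squared length never falls below `m`, which keeps the motion away from the spurious rest
  -- point at the leader and gives a uniform decay rate.
  set m := min (‖e 0‖ ^ 2) (‖f‖ ^ 2)
  have hm : 0 < m := by positivity
  have hlow : ∀ t, 0 ≤ t → m ≤ ‖e t‖ ^ 2 := by
    intro t ht
    have := le_of_deriv_nonpos_above (B := -m) (fun s hs => (h.hasDeriv_sq s hs).fun_neg)
      (fun s _ hle => ?_) (neg_le_neg (min_le_left _ _)) t ht
    · linarith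
    · have h1 : ‖e s‖ ^ 2 - ‖f‖ ^ 2 ≤ 0 := by
        have : m ≤ ‖f‖ ^ 2 := min_le_right _ _
        linarith
      have h2 : 0 ≤ 2 * α * ‖e s‖ ^ 2 := by positivity
      nlinarith
  have hz := tendsto_zero_of_deriv_neg h.hasDeriv_err (fun t => sq_nonneg _) (fun ε hε => by
    refine ⟨4 * α * m * ε, by positivity, ?_⟩
    filter_upwards [eventually_ge_atTop 0] with t ht hle
    rw [neg_le_neg_iff]
    exact mul_le_mul (by have := hlow t ht; gcongr) hle hε.le (by positivity))
  have hz' : Tendsto (fun t => |‖e t‖ ^ 2 - ‖f‖ ^ 2| / ‖f‖) atTop (𝓝 0) := by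
    have := (Real.continuous_sqrt.tendsto 0).comp hz
    simp only [Function.comp_def, Real.sqrt_sq_eq_abs, Real.sqrt_zero] at this
    simpa using this.div_const ‖f‖
  rw [tendsto_iff_dist_tendsto_zero]
  refine squeeze_zero' (Eventually.of_forall fun _ => dist_nonneg) ?_ hz'
  filter_upwards [eventually_ge_atTop 0] with t ht using h.dist_le hf ht

theorem norm_le (h : IsFirstFollower α f e) (hα : 0 < α) (hf : f ≠ 0) {t : ℝ} (ht : 0 ≤ t) :
    ‖e t‖ ≤ |‖e 0‖ ^ 2 - ‖f‖ ^ 2| / ‖f‖ + ‖f‖ := by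
  have h1 := h.dist_le hf ht
  have h2 : |‖e t‖ ^ 2 - ‖f‖ ^ 2| / ‖f‖ ≤ |‖e 0‖ ^ 2 - ‖f‖ ^ 2| / ‖f‖ := by
    have := h.err_le hα ht; gcongr
  have h3 := norm_sub_norm_le (e t) f
  rw [dist_eq_norm] at h1
  linarith

end IsFirstFollower

/-! ### Forward solutions of bounded Lipschitz fields. -/

theorem exists_forward_solution {E : Type*} [NormedAddCommGroup E] [NormedSpace ℝ E]
    [CompleteSpace E] {v : E → E} {K : NNReal} (hK : LipschitzWith K v) {L : ℝ}
    (hL : ∀ x, ‖v x‖ ≤ L) (x₀ : E) :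
    ∃ p : ℝ → E, p 0 = x₀ ∧ ∀ t, 0 ≤ t → HasDerivWithinAt p (v (p t)) (Set.Ici 0) t := by
  have hL0 : 0 ≤ L := (norm_nonneg _).trans (hL x₀)
  have hloc : ∀ m : ℕ, ∃ f : ℝ → E, f 0 = x₀ ∧
      ∀ t ∈ Set.Icc (0 : ℝ) (m + 1), HasDerivWithinAt f (v (f t)) (Set.Icc 0 (m + 1)) t := by
    intro m
    have hm : (0 : ℝ) ≤ m + 1 := by positivity
    have hPL : IsPicardLindelof (fun _ => v) (tmin := 0) (tmax := m + 1)
        ⟨0, le_rfl, hm⟩ x₀ (L.toNNReal * (m + 1)) 0 L.toNNReal K :=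
      { lipschitzOnWith := fun t _ => hK.lipschitzOnWith
        continuousOn := fun _ _ => continuousOn_const
        norm_le := fun t _ x _ => by rw [Real.coe_toNNReal _ hL0]; exact hL x
        mul_max_le := by simp [hm] }
    obtain ⟨f, h0, hf⟩ := hPL.exists_eq_forall_mem_Icc_hasDerivWithinAt₀
    exact ⟨f, h0, hf⟩
  choose f hf0 hf using hloc
  have hright : ∀ (m : ℕ) (T : ℝ), T ≤ m + 1 → ∀ t ∈ Set.Ico 0 T,
      HasDerivWithinAt (f m) (v (f m t)) (Set.Ici t) t := by
    intro m T hT t ht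
    have h1 : t < m + 1 := ht.2.trans_le hT
    refine ((hf m t ⟨ht.1, h1.le⟩).mono_of_mem_nhdsWithin ?_)
    exact mem_of_superset (Icc_mem_nhdsGE h1) (Set.Icc_subset_Icc_left ht.1)
  have huniq : ∀ m k : ℕ, m ≤ k → Set.EqOn (f m) (f k) (Set.Icc 0 (m + 1)) := by
    intro m k hmk
    have hmk' : (m : ℝ) + 1 ≤ k + 1 := by gcongr
    refine ODE_solution_unique_of_mem_Icc_right (v := fun _ => v) (s := fun _ => Set.univ)
      (K := K) (fun t _ => hK.lipschitzOnWith)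
      (fun t ht => (hf m t ht).continuousWithinAt) (hright m _ le_rfl) (fun _ _ => trivial)
      (fun t ht => ((hf k t ⟨ht.1, ht.2.trans hmk'⟩).continuousWithinAt).mono
        (Set.Icc_subset_Icc_right hmk')) (hright k _ hmk') (fun _ _ => trivial) ?_
    rw [hf0, hf0]
  -- The piece with index `⌈t⌉₊` lives up to `⌈t⌉₊ + 1`, so `t` is never its right endpoint.
  refine ⟨fun t => f ⌈t⌉₊ t, by simp [hf0], fun t ht => ?_⟩
  have heq : ∀ s ∈ Set.Icc (0 : ℝ) (⌈t⌉₊ + 1), f ⌈s⌉₊ s = f (⌈t⌉₊ + 1) s := by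
    intro s hs
    refine huniq _ _ ?_ ⟨hs.1, (Nat.le_ceil s).trans (by linarith)⟩
    rw [Nat.ceil_le]; exact_mod_cast hs.2
  have htlt : t < ⌈t⌉₊ + 1 := (Nat.le_ceil t).trans_lt (by linarith)
  have hnhds : Set.Icc (0 : ℝ) (⌈t⌉₊ + 1) ∈ 𝓝[Set.Ici 0] t := by
    have : Set.Iic ((⌈t⌉₊ : ℝ) + 1) ∈ 𝓝 t := Iic_mem_nhds htlt
    filter_upwards [mem_nhdsWithin_of_mem_nhds this, self_mem_nhdsWithin] with s h1 h2
      using ⟨h2, h1⟩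
  have hd := hf (⌈t⌉₊ + 1) t ⟨ht, by push_cast; linarith⟩
  have hd' : HasDerivWithinAt (f (⌈t⌉₊ + 1)) (v (f ⌈t⌉₊ t)) (Set.Ici 0) t := by
    rw [heq t ⟨ht, htlt.le⟩]
    refine hd.mono_of_mem_nhdsWithin (mem_of_superset hnhds (Set.Icc_subset_Icc_right ?_))
    push_cast; linarith
  exact hd'.congr_of_eventuallyEq (mem_of_superset hnhds heq) (heq t ⟨ht, htlt.le⟩)

/-! ### Leader-first-follower graphs -/

namespace IsTri

variable {n : ℕ} {G : Digraph (Fin (n + 2))} {i j k : Fin (n + 2)}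

theorem one_lt (h : IsTri G i j k) : 1 < k := by
  have h1 := Fin.lt_def.1 h.1
  have h2 := Fin.lt_def.1 h.2.1
  rw [Fin.lt_def, Fin.val_one]
  omega

end IsTri

theorem one_lt_of_ne {n : ℕ} {k : Fin (n + 2)} (h0 : k ≠ 0) (h1 : k ≠ 1) : 1 < k := by
  have h0' : k.val ≠ 0 := fun h => h0 (Fin.ext h)
  have h1' : k.val ≠ 1 := fun h => h1 (Fin.ext (by rw [h, Fin.val_one]))
  rw [Fin.lt_def, Fin.val_one]
  omega

namespace IsLFF

variable {n : ℕ} {G : Digraph (Fin (n + 2))} {i j k : Fin (n + 2)}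

theorem adj_one_zero (hG : IsLFF G) : G.Adj 1 0 := by
  obtain ⟨a, ha⟩ := Set.ncard_eq_one.1 hG.out_first
  have h1 : G.Adj 1 a := by
    have : a ∈ {j | G.Adj 1 j} := by rw [ha]; rfl
    exact this
  have h2 := Fin.lt_def.1 (hG.descending 1 a h1)
  have : a = 0 := by
    rw [Fin.val_one] at h2
    exact Fin.ext (by rw [Fin.val_zero]; omega)
  rwa [this] at h1

theorem exists_tri (hG : IsLFF G) (hk : 1 < k) : ∃ i j, IsTri G i j k := by
  obtain ⟨a, b, hab, hs⟩ := Set.ncard_eq_two.1 (hG.out_ordinary k hk)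
  have ha : G.Adj k a := by
    have : a ∈ {j | G.Adj k j} := by rw [hs]; simp
    exact this
  have hb : G.Adj k b := by
    have : b ∈ {j | G.Adj k j} := by rw [hs]; simp
    exact this
  rcases lt_or_gt_of_ne hab with h | h
  · exact ⟨a, b, h, hG.descending _ _ hb, ha, hb⟩
  · exact ⟨b, a, h, hG.descending _ _ ha, hb, ha⟩

theorem tri_unique (hG : IsLFF G) {i' j' : Fin (n + 2)} (h : IsTri G i j k)
    (h' : IsTri G i' j' k) : i = i' ∧ j = j' := by
  obtain ⟨a, b, hab, hs⟩ := Set.ncard_eq_two.1 (hG.out_ordinary k h.one_lt)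
  have key : ∀ x, G.Adj k x → x = a ∨ x = b := by
    intro x hx
    have : x ∈ {j | G.Adj k j} := hx
    rw [hs] at this
    simpa using this
  have h1 := h.1
  have h2 := h'.1
  rcases key _ h.2.2.1 with rfl | rfl <;> rcases key _ h.2.2.2 with rfl | rfl <;>
    rcases key _ h'.2.2.1 with rfl | rfl <;> rcases key _ h'.2.2.2 with rfl | rfl <;>
    first
      | exact ⟨rfl, rfl⟩
      | exact absurd h1 (lt_irrefl _)
      | exact absurd h2 (lt_irrefl _)
      | exact absurd h1 h2.asymm

end IsLFF

/-! ### Global existence -/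

theorem closedLoop_ordinary_eq {n : ℕ} (ps p : Fin (n + 2) → Plane) (α β : Fin (n + 2) → ℝ)
    (i j k : Fin (n + 2)) :
    -(α k • (zErr ps p k i • (p k - p i) + zErr ps p k j • (p k - p j)))
        - (β k * areaErr ps p i j k) • JT ((p k - p i) - (p k - p j)) =
      agentField (α k) (β k) ‖ps k - ps i‖ ‖ps k - ps j‖ (signedArea (ps i) (ps j) (ps k))
        (p i) (p j) (p k) := rfl

/-- Puts the three control laws into one vector field of the form needed by
`exists_solution_of_cascade`: the escape radius of agent `k` depends only on a bound for smaller
labels. -/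
theorem exists_agent_velocity {n : ℕ} {G : Digraph (Fin (n + 2))} (hG : IsLFF G)
    (ps : Fin (n + 2) → Plane) {α β : Fin (n + 2) → ℝ} (hα : ∀ k, 0 < k → 0 < α k)
    (hβ : ∀ k, 1 < k → 0 < β k) (k : Fin (n + 2)) :
    ∃ F : (Fin (n + 2) → Plane) → Plane, ContDiff ℝ 1 F ∧
      (∀ M, 0 ≤ M → ∃ B, ∀ p : Fin (n + 2) → Plane, (∀ i < k, ‖p i‖ ≤ M) → B ≤ ‖p k‖ →
        inner ℝ (p k) (F p) ≤ 0) ∧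
      (k = 0 → ∀ p, F p = 0) ∧
      (k = 1 → ∀ p, F p = -((α 1 * zErr ps p 1 0) • (p 1 - p 0))) ∧
      (∀ i j, IsTri G i j k → ∀ p, F p =
        agentField (α k) (β k) ‖ps k - ps i‖ ‖ps k - ps j‖ (signedArea (ps i) (ps j) (ps k))
          (p i) (p j) (p k)) := by
  have h01 : (0 : Fin (n + 2)) < 1 := by simp
  by_cases hk0 : k = 0
  · subst hk0
    refine ⟨fun _ => 0, contDiff_const, fun M _ => ⟨0, fun p _ _ => by simp⟩, fun _ _ => rfl,
      fun h => absurd h h01.ne, fun i j h => absurd (h01.trans h.one_lt) (lt_irrefl _)⟩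
  by_cases hk1 : k = 1
  · subst hk1
    refine ⟨fun p => -((α 1 * zErr ps p 1 0) • (p 1 - p 0)), ?_, fun M hM => ?_,
      fun h => absurd h hk0, fun _ _ => rfl, fun i j h => absurd h.one_lt (lt_irrefl _)⟩
    · have h : ContDiff ℝ 1 fun p : Fin (n + 2) → Plane => p 1 - p 0 := by fun_prop
      have h2 := h.norm_sq ℝ
      unfold zErr
      fun_prop
    · refine ⟨2 * M + 3 * |dist_des ps 1 0|, fun p hp hB => ?_⟩
      have h1 := inner_distance_term_ge hM (hp 0 h01) hB
      have h2 := mul_le_mul_of_nonneg_left h1 (hα 1 h01).le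
      have h3 : 0 ≤ α 1 * (‖p 1‖ ^ 4 / 16) := mul_nonneg (hα 1 h01).le (by positivity)
      rw [inner_neg_right, inner_smul_right]
      unfold zErr
      linarith
  · have hk : 1 < k := one_lt_of_ne hk0 hk1
    obtain ⟨i, j, hij⟩ := hG.exists_tri hk
    refine ⟨fun p => agentField (α k) (β k) ‖ps k - ps i‖ ‖ps k - ps j‖
      (signedArea (ps i) (ps j) (ps k)) (p i) (p j) (p k), ?_, fun M hM => ?_,
      fun h => absurd h hk0, fun h => absurd h hk1, fun i' j' h' p => ?_⟩
    · exact contDiff_agentField (by fun_prop) (by fun_prop) (by fun_prop) _ _ _ _ _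
    · obtain ⟨B, -, hB⟩ := exists_inner_agentField_nonpos (hα k (h01.trans hk)) (hβ k hk).le
        ‖ps k - ps i‖ ‖ps k - ps j‖ (signedArea (ps i) (ps j) (ps k)) hM
      exact ⟨B, fun p hp hle => hB _ _ _ (hp i (hij.1.trans hij.2.1)) (hp j hij.2.1) hle⟩
    · obtain ⟨rfl, rfl⟩ := hG.tri_unique hij h'
      rfl

/-- A vector field on a product such that each component points inwards far away, uniformly in the
components with smaller labels, has global forward solutions. -/
theorem exists_solution_of_cascade {m : ℕ} {F : Fin m → (Fin m → Plane) → Plane}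
    (hF : ∀ k, ContDiff ℝ 1 (F k))
    (hB : ∀ k M, 0 ≤ M → ∃ B, ∀ p : Fin m → Plane, (∀ i < k, ‖p i‖ ≤ M) → B ≤ ‖p k‖ →
        inner ℝ (p k) (F k p) ≤ 0) (p₀ : Fin m → Plane) :
    ∃ p : ℝ → Fin m → Plane, p 0 = p₀ ∧ ∀ t, 0 ≤ t → ∀ k,
      HasDerivWithinAt (fun s => p s k) (F k (p t)) (Set.Ici 0) t := by
  have hB' : ∀ M : ℝ, ∃ M', M ≤ M' ∧ (0 ≤ M → ∀ k, ∀ p : Fin m → Plane,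
      (∀ i < k, ‖p i‖ ≤ M) → M' ≤ ‖p k‖ → inner ℝ (p k) (F k p) ≤ 0) := by
    intro M
    by_cases hM : 0 ≤ M
    · choose B hB using fun k => hB k M hM
      refine ⟨M + ∑ k, |B k|, le_add_of_nonneg_right (by positivity), fun _ k p hp hle => ?_⟩
      refine hB k p hp (le_trans ?_ hle)
      have := Finset.single_le_sum (f := fun k => |B k|) (fun i _ => abs_nonneg _)
        (Finset.mem_univ k)
      have h2 := le_abs_self (B k)
      linarith
    · exact ⟨M, le_rfl, fun h => absurd h hM⟩
  choose b hb1 hb2 using hB'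
  -- Agent `r` will be confined to radius `R (r + 1)`, given that earlier agents stay within `R r`.
  set R : ℕ → ℝ := fun r => b^[r] ‖p₀‖
  have hRsucc : ∀ r, R (r + 1) = b (R r) := fun r => Function.iterate_succ_apply' b r _
  have hRmono : Monotone R := monotone_nat_of_le_succ fun r => by rw [hRsucc]; exact hb1 _
  have hR0 : ∀ r, ‖p₀‖ ≤ R r := fun r => hRmono (Nat.zero_le r)
  have hRm : 0 ≤ R m := (norm_nonneg _).trans (hR0 m)
  -- The cutoff makes the field bounded and Lipschitz. Being nonnegative, it preserves the
  -- inward-pointing property, so the radii still hold and the solution stays where the cutoff is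
  -- `1`.
  let φ : ContDiffBump (0 : Fin m → Plane) :=
    { rIn := R m + 1, rOut := R m + 2, rIn_pos := by positivity, rIn_lt_rOut := by linarith }
  set v : (Fin m → Plane) → (Fin m → Plane) := fun p => φ p • fun k => F k p with hv
  have hvC : ContDiff ℝ 1 v := φ.contDiff.smul (contDiff_pi.2 hF)
  have hvS : HasCompactSupport v := φ.hasCompactSupport.smul_right
  obtain ⟨K, hK⟩ := hvC.lipschitzWith_of_hasCompactSupport hvS one_ne_zero
  obtain ⟨L, hL⟩ := hvC.continuous.bounded_above_of_compact_support hvS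
  obtain ⟨p, hp0, hp⟩ := exists_forward_solution hK hL p₀
  have hpk : ∀ k t, 0 ≤ t →
      HasDerivWithinAt (fun s => p s k) (φ (p t) • F k (p t)) (Set.Ici 0) t :=
    fun k t ht => hasDerivWithinAt_pi.1 (hp t ht) k
  have hbound : ∀ r : ℕ, ∀ k : Fin m, k.val = r → ∀ t, 0 ≤ t → ‖p t k‖ ≤ R (r + 1) := by
    intro r
    induction r using Nat.strong_induction_on with
    | _ r ih =>
      intro k hk
      refine norm_le_of_inner_nonpos (hpk k) (fun t ht hle => ?_) ?_
      · rw [inner_smul_right]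
        refine mul_nonpos_of_nonneg_of_nonpos φ.nonneg ?_
        rw [hRsucc] at hle
        refine hb2 (R r) ((norm_nonneg _).trans (hR0 r)) k (p t) (fun i hi => ?_) hle
        have hir : i.val < r := hk ▸ Fin.lt_def.1 hi
        exact (ih i.val hir i rfl t ht).trans (hRmono hir)
      · rw [hp0]
        exact (norm_le_pi_norm p₀ k).trans (hR0 _)
  refine ⟨p, hp0, fun t ht k => ?_⟩
  have h1 : φ (p t) = 1 := by
    apply φ.one_of_mem_closedBall
    rw [mem_closedBall_zero_iff, pi_norm_le_iff_of_nonneg (by change 0 ≤ R m + 1; linarith)]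
    intro i
    have := (hbound i.val i rfl t ht).trans (hRmono i.isLt)
    change ‖p t i‖ ≤ R m + 1
    linarith
  simpa [h1] using hpk k t ht

theorem exists_isClosedLoop {n : ℕ} {G : Digraph (Fin (n + 2))} (hG : IsLFF G)
    (ps : Fin (n + 2) → Plane) {α β : Fin (n + 2) → ℝ} (hα : ∀ k, 0 < k → 0 < α k)
    (hβ : ∀ k, 1 < k → 0 < β k) (p₀ : Fin (n + 2) → Plane) :
    ∃ p, IsClosedLoop G ps α β p ∧ p 0 = p₀ := by
  choose F hC hB h0 h1 h2 using exists_agent_velocity hG ps hα hβ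
  obtain ⟨p, hp0, hp⟩ := exists_solution_of_cascade hC hB p₀
  refine ⟨p, ⟨fun t ht => ?_, fun t ht => ?_, fun i j k hijk t ht => ?_⟩, hp0⟩
  · simpa [h0 0 rfl] using hp t ht 0
  · simpa [h1 1 rfl] using hp t ht 1
  · rw [closedLoop_ordinary_eq, ← h2 k i j hijk]
    exact hp t ht k

/-! ### Rigid motions -/

/-- The rigid motion with linear part `[c, -s; s, c]` that sends `b` to `a`. -/
def rigidMove (c s : ℝ) (a b x : Plane) : Plane := a + (c • (x - b) + s • JTL (x - b))

section Rigid

variable {c s : ℝ} (a b : Plane)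

theorem rigidMove_apply_zero (x : Plane) :
    rigidMove c s a b x 0 = a 0 + (c * (x 0 - b 0) - s * (x 1 - b 1)) := by
  simp [rigidMove, JTL_apply, JT_apply_zero]; ring

theorem rigidMove_apply_one (x : Plane) :
    rigidMove c s a b x 1 = a 1 + (c * (x 1 - b 1) + s * (x 0 - b 0)) := by
  simp [rigidMove, JTL_apply, JT_apply_one]

theorem rigidMove_self : rigidMove c s a b b = a := by
  simp [rigidMove]

theorem norm_rigidMove_sub (h : c ^ 2 + s ^ 2 = 1) (x y : Plane) :
    ‖rigidMove c s a b x - rigidMove c s a b y‖ = ‖x - y‖ := by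
  rw [← sq_eq_sq₀ (norm_nonneg _) (norm_nonneg _)]
  simp only [plane_norm_sq, PiLp.sub_apply, rigidMove_apply_zero, rigidMove_apply_one]
  linear_combination ((x 0 - y 0) ^ 2 + (x 1 - y 1) ^ 2) * h

theorem signedArea_rigidMove (h : c ^ 2 + s ^ 2 = 1) (x y z : Plane) :
    signedArea (rigidMove c s a b x) (rigidMove c s a b y) (rigidMove c s a b z)
      = signedArea x y z := by
  simp only [signedArea_eq, rigidMove_apply_zero, rigidMove_apply_one]
  linear_combination 1 / 2 * ((y 0 - x 0) * (z 1 - x 1) - (y 1 - x 1) * (z 0 - x 0)) * h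

theorem rigidMove_inverse (h : c ^ 2 + s ^ 2 = 1) (x : Plane) :
    rigidMove c (-s) b a (rigidMove c s a b x) = x := by
  apply plane_ext
  · simp only [rigidMove_apply_zero, rigidMove_apply_one]
    linear_combination (x 0 - b 0) * h
  · simp only [rigidMove_apply_zero, rigidMove_apply_one]
    linear_combination (x 1 - b 1) * h

theorem continuous_rigidMove : Continuous (rigidMove c s a b) := by
  unfold rigidMove; fun_prop

theorem hasDerivWithinAt_rigidMove {x : ℝ → Plane} {u : Plane} {S : Set ℝ} {t : ℝ}
    (h : HasDerivWithinAt x u S t) :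
    HasDerivWithinAt (fun r => rigidMove c s a b (x r)) (c • u + s • JTL u) S t := by
  have h1 := h.sub_const b
  exact ((h1.const_smul c).add ((JTL.hasFDerivAt.comp_hasDerivWithinAt t h1).const_smul
    s)).const_add a

/-- The control uses only differences, lengths and signed areas, and `J` commutes with plane
rotations. -/
theorem agentField_rigidMove (h : c ^ 2 + s ^ 2 = 1) (α β d₁ d₂ S : ℝ) (y z x : Plane) :
    agentField α β d₁ d₂ S (rigidMove c s a b y) (rigidMove c s a b z) (rigidMove c s a b x)
      = c • agentField α β d₁ d₂ S y z x + s • JTL (agentField α β d₁ d₂ S y z x) := by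
  apply plane_ext
  · simp only [PiLp.add_apply, PiLp.smul_apply, smul_eq_mul, JTL_apply, JT_apply_zero,
      agentField_apply_zero, agentField_apply_one, norm_rigidMove_sub a b h,
      signedArea_rigidMove a b h, rigidMove_apply_zero, rigidMove_apply_one]
    ring
  · simp only [PiLp.add_apply, PiLp.smul_apply, smul_eq_mul, JTL_apply, JT_apply_one,
      agentField_apply_zero, agentField_apply_one, norm_rigidMove_sub a b h,
      signedArea_rigidMove a b h, rigidMove_apply_zero, rigidMove_apply_one]
    ring

end Rigid

/-- Some rigid motion sends `p` to `x` and the ray from `p` through `q` to the ray from `x`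
through `y`. -/
theorem exists_rigidMove_align {p q x y : Plane} (hpq : p ≠ q) (hxy : x ≠ y) :
    ∃ c s : ℝ, c ^ 2 + s ^ 2 = 1 ∧ ∃ l : ℝ, 0 < l ∧ rigidMove c s x p q - x = l • (y - x) := by
  have h1 : 0 < ‖q - p‖ := norm_pos_iff.2 (sub_ne_zero.2 hpq.symm)
  have h2 : 0 < ‖y - x‖ := norm_pos_iff.2 (sub_ne_zero.2 hxy.symm)
  have e1 := plane_norm_sq (q - p)
  have e2 := plane_norm_sq (y - x)
  simp only [PiLp.sub_apply] at e1 e2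
  set A := ‖q - p‖
  set B := ‖y - x‖
  refine ⟨((q 0 - p 0) * (y 0 - x 0) + (q 1 - p 1) * (y 1 - x 1)) / (A * B),
    ((q 0 - p 0) * (y 1 - x 1) - (q 1 - p 1) * (y 0 - x 0)) / (A * B), ?_, A / B,
    by positivity, ?_⟩
  · field_simp
    rw [e1, e2]; ring
  · apply plane_ext
    · simp only [PiLp.sub_apply, PiLp.smul_apply, smul_eq_mul, rigidMove_apply_zero]
      field_simp
      rw [e1]; ring
    · simp only [PiLp.sub_apply, PiLp.smul_apply, smul_eq_mul, rigidMove_apply_one]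
      field_simp
      rw [e1]; ring

/-! ### The whole formation. -/

section Formation

variable {n : ℕ} {G : Digraph (Fin (n + 2))} {ps : Fin (n + 2) → Plane}
  {α β : Fin (n + 2) → ℝ} {p : ℝ → Fin (n + 2) → Plane}

theorem zErr_rigidMove {c s : ℝ} (h : c ^ 2 + s ^ 2 = 1) (a b : Plane) (q : Fin (n + 2) → Plane)
    (j i : Fin (n + 2)) : zErr ps (fun k => rigidMove c s a b (q k)) j i = zErr ps q j i := by
  simp only [zErr, norm_rigidMove_sub a b h]

theorem chi_rigidMove {c s : ℝ} (h : c ^ 2 + s ^ 2 = 1) (a b : Plane) (q : Fin (n + 2) → Plane) :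
    chi G (fun k => rigidMove c s a b (q k)) = chi G q := by
  funext T
  simp only [chi, signedArea_rigidMove a b h]

theorem stackedErr_rigidMove {c s : ℝ} (h : c ^ 2 + s ^ 2 = 1) (a b : Plane)
    (q : Fin (n + 2) → Plane) :
    stackedErr G ps (fun k => rigidMove c s a b (q k)) = stackedErr G ps q := by
  simp only [stackedErr, zErr_rigidMove h, areaErr, signedArea_rigidMove a b h]

theorem IsClosedLoop.rigidMove {c s : ℝ} (h : c ^ 2 + s ^ 2 = 1) (a b : Plane)
    (hp : IsClosedLoop G ps α β p) :
    IsClosedLoop G ps α β (fun t k => rigidMove c s a b (p t k)) := by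
  refine ⟨fun t ht => ?_, fun t ht => ?_, fun i j k hijk t ht => ?_⟩
  · simpa using hasDerivWithinAt_rigidMove (c := c) (s := s) a b (hp.leader t ht)
  · refine (hasDerivWithinAt_rigidMove (c := c) (s := s) a b (hp.first t ht)).congr_deriv ?_
    rw [zErr_rigidMove h]
    apply plane_ext
    · simp [JTL_apply, JT_apply_zero, rigidMove_apply_zero]; ring
    · simp [JTL_apply, JT_apply_one, rigidMove_apply_one]; ring
  · refine (hasDerivWithinAt_rigidMove (c := c) (s := s) a b
      (hp.ordinary i j k hijk t ht)).congr_deriv ?_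
    simp only [closedLoop_ordinary_eq, agentField_rigidMove a b h]

theorem continuous_chi : Continuous (chi G) := by
  refine continuous_pi fun T => ?_
  exact (contDiff_signedArea (E := Fin (n + 2) → Plane) (by fun_prop) (by fun_prop)
    (by fun_prop)).continuous

theorem continuous_stackedErr : Continuous (stackedErr G ps) := by
  refine Continuous.prodMk (continuous_pi fun e => ?_) ?_
  · unfold zErr; fun_prop
  · exact (continuous_chi (G := G)).sub continuous_const

theorem stackedErr_self : stackedErr G ps ps = 0 := by
  ext <;> simp [stackedErr, zErr, dist_des, areaErr]

/-- A motion whose leader sits at its desired position and whose first follower sits in the desired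
direction. -/
structure IsAligned (G : Digraph (Fin (n + 2))) (ps : Fin (n + 2) → Plane)
    (α β : Fin (n + 2) → ℝ) (p : ℝ → Fin (n + 2) → Plane) : Prop where
  closedLoop : IsClosedLoop G ps α β p
  leader : p 0 0 = ps 0
  first : ∃ l : ℝ, 0 < l ∧ p 0 1 - ps 0 = l • (ps 1 - ps 0)

namespace IsAligned

theorem leader_eq (h : IsAligned G ps α β p) {t : ℝ} (ht : 0 ≤ t) : p t 0 = ps 0 := by
  rw [← h.leader]
  exact constant_of_has_deriv_right_zero (f := fun s => p s 0) (a := 0) (b := t)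
    (fun s hs => (h.closedLoop.leader s hs.1).continuousWithinAt.mono fun r hr => hr.1)
    (fun s hs => (h.closedLoop.leader s hs.1).mono fun r hr => hs.1.trans hr) t ⟨ht, le_rfl⟩

theorem isFirstFollower (h : IsAligned G ps α β p) :
    IsFirstFollower (α 1) (ps 1 - ps 0) (fun t => p t 1 - ps 0) := by
  refine ⟨fun t ht => ?_, h.first⟩
  have := (h.closedLoop.first t ht).sub_const (ps 0)
  rw [zErr, h.leader_eq ht] at this
  exact this

theorem hasDerivWithinAt (h : IsAligned G ps α β p) {i j k : Fin (n + 2)} (hijk : IsTri G i j k)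
    (t : ℝ) (ht : 0 ≤ t) : HasDerivWithinAt (fun s => p s k)
      (agentField (α k) (β k) ‖ps k - ps i‖ ‖ps k - ps j‖ (signedArea (ps i) (ps j) (ps k))
        (p t i) (p t j) (p t k)) (Set.Ici 0) t :=
  h.closedLoop.ordinary i j k hijk t ht

theorem bounded_and_tendsto (h : IsAligned G ps α β p) (hG : IsLFF G) (hps : ps 0 ≠ ps 1)
    (hα : 0 < α 1)
    (hT : ∀ i j k, IsTri G i j k → IsAgentTarget (α k) (β k) (ps i) (ps j) (ps k)) :
    ∀ k, (∃ M, ∀ t, 0 ≤ t → ‖p t k‖ ≤ M) ∧ Tendsto (fun t => p t k) atTop (𝓝 (ps k)) := by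
  intro k
  induction k using WellFoundedLT.induction with
  | _ k ih =>
    have hf : ps 1 - ps 0 ≠ 0 := sub_ne_zero.2 hps.symm
    by_cases hk0 : k = 0
    · subst hk0
      refine ⟨⟨‖ps 0‖, fun t ht => by rw [h.leader_eq ht]⟩, ?_⟩
      refine tendsto_const_nhds.congr' ?_
      filter_upwards [eventually_ge_atTop 0] with t ht using (h.leader_eq ht).symm
    by_cases hk1 : k = 1
    · subst hk1
      refine ⟨⟨|‖p 0 1 - ps 0‖ ^ 2 - ‖ps 1 - ps 0‖ ^ 2| / ‖ps 1 - ps 0‖ + ‖ps 1 - ps 0‖ + ‖ps 0‖,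
        fun t ht => ?_⟩, ?_⟩
      · have h1 := h.isFirstFollower.norm_le hα hf ht
        have h2 := norm_add_le (p t 1 - ps 0) (ps 0)
        rw [sub_add_cancel] at h2
        linarith
      · have := (h.isFirstFollower.tendsto hα hf).add_const (ps 0)
        simpa using this
    · obtain ⟨i, j, hij⟩ := hG.exists_tri (one_lt_of_ne hk0 hk1)
      have hi := ih i (hij.1.trans hij.2.1)
      have hj := ih j hij.2.1
      exact (hT i j k hij).bounded_and_tendsto (h.hasDerivWithinAt hij) hi.1 hj.1 hi.2 hj.2

end IsAligned

/-- Only the initial errors are assumed small, so at time `0` the position of agent `k` is first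
recovered from its errors and its neighbours (`exists_dist_lt_of_errors`); then
`IsAgentTarget.stable` carries closeness to all times. -/
theorem eventually_stable (hG : IsLFF G) (hps : ps 0 ≠ ps 1) (hα : 0 < α 1)
    (hT : ∀ i j k, IsTri G i j k → IsAgentTarget (α k) (β k) (ps i) (ps j) (ps k))
    (k : Fin (n + 2)) : ∀ ε > 0, ∀ᶠ x in 𝓝 (0 : (EdgeIdx G → ℝ) × (TriIdx G → ℝ)),
      ∀ p, IsAligned G ps α β p → stackedErr G ps (p 0) = x →
        ∀ t, 0 ≤ t → dist (p t k) (ps k) < ε := by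
  have hedge : ∀ (e : EdgeIdx G) {δ : ℝ}, 0 < δ →
      ∀ᶠ x in 𝓝 (0 : (EdgeIdx G → ℝ) × (TriIdx G → ℝ)), |x.1 e| < δ := by
    intro e δ hδ
    have : Continuous fun x : (EdgeIdx G → ℝ) × (TriIdx G → ℝ) => |x.1 e| := by fun_prop
    exact (this.tendsto 0).eventually (gt_mem_nhds (by simpa using hδ))
  have harea : ∀ (T : TriIdx G) {δ : ℝ}, 0 < δ →
      ∀ᶠ x in 𝓝 (0 : (EdgeIdx G → ℝ) × (TriIdx G → ℝ)), |x.2 T| < δ := by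
    intro T δ hδ
    have : Continuous fun x : (EdgeIdx G → ℝ) × (TriIdx G → ℝ) => |x.2 T| := by fun_prop
    exact (this.tendsto 0).eventually (gt_mem_nhds (by simpa using hδ))
  induction k using WellFoundedLT.induction with
  | _ k ih =>
    intro ε hε
    have hf : ps 1 - ps 0 ≠ 0 := sub_ne_zero.2 hps.symm
    have hf' : 0 < ‖ps 1 - ps 0‖ := norm_pos_iff.2 hf
    by_cases hk0 : k = 0
    · subst hk0
      refine Eventually.of_forall fun x p hp _ t ht => ?_
      rwa [hp.leader_eq ht, dist_self]
    by_cases hk1 : k = 1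
    · subst hk1
      filter_upwards [hedge ⟨(1, 0), hG.adj_one_zero⟩ (mul_pos hε hf')] with x hx p hp hpx t ht
      have h1 := hp.isFirstFollower.dist_le hf ht
      have h2 := hp.isFirstFollower.err_le hα ht
      rw [dist_sub_right] at h1
      refine h1.trans_lt ((div_lt_iff₀ hf').2 (h2.trans_lt ?_))
      rw [← hpx] at hx
      simpa [stackedErr, zErr, dist_des, hp.leader] using hx
    · obtain ⟨i, j, hij⟩ := hG.exists_tri (one_lt_of_ne hk0 hk1)
      have hik := hij.1.trans hij.2.1
      obtain ⟨δ, hδ, hst⟩ := (hT i j k hij).stable hε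
      obtain ⟨η, hη, hrec⟩ := exists_dist_lt_of_errors (c := ps k) (hT i j k hij).base_ne hδ
      -- The tolerance `δ` on the neighbours is needed at all times, `η` only at time `0`.
      filter_upwards [ih i hik _ hδ, ih j hij.2.1 _ hδ, ih i hik _ hη, ih j hij.2.1 _ hη,
        hedge ⟨(k, i), hij.2.2.1⟩ hη, hedge ⟨(k, j), hij.2.2.2⟩ hη,
        harea ⟨(i, j, k), hij⟩ hη] with x hiδ hjδ hiη hjη hki hkj hS p hp hpx
      rw [← hpx] at hki hkj hS
      exact hst _ _ _ (hp.hasDerivWithinAt hij) (hiδ p hp hpx) (hjδ p hp hpx)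
        (hrec _ _ _ (hiη p hp hpx 0 le_rfl) (hjη p hp hpx 0 le_rfl) hki hkj hS)

theorem exists_aligned (hps : ps 0 ≠ ps 1) (hp : IsClosedLoop G ps α β p) (h0 : p 0 0 ≠ p 0 1) :
    ∃ c s : ℝ, c ^ 2 + s ^ 2 = 1 ∧
      IsAligned G ps α β (fun t k => rigidMove c s (ps 0) (p 0 0) (p t k)) := by
  obtain ⟨c, s, hcs, l, hl, hal⟩ := exists_rigidMove_align h0 hps
  exact ⟨c, s, hcs, hp.rigidMove hcs _ _, rigidMove_self _ _, l, hl, hal⟩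

/-- In the aligned frame the motion tends to `ps`; undoing the rigid motion gives one limit
configuration strongly congruent to `ps`. The convergence claims then follow by continuity. -/
theorem exists_limit (hG : IsLFF G) (hps : ps 0 ≠ ps 1) (hα : 0 < α 1)
    (hT : ∀ i j k, IsTri G i j k → IsAgentTarget (α k) (β k) (ps i) (ps j) (ps k))
    (hp : IsClosedLoop G ps α β p) (h0 : p 0 0 ≠ p 0 1) :
    ∃ q : Fin (n + 2) → Plane, Tendsto p atTop (𝓝 q) ∧
      (∀ i j, ‖q i - q j‖ = ‖ps i - ps j‖) ∧ chi G q = chi G ps ∧ stackedErr G ps q = 0 := by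
  obtain ⟨c, s, hcs, hal⟩ := exists_aligned hps hp h0
  have hcs' : c ^ 2 + (-s) ^ 2 = 1 := by rw [neg_sq, hcs]
  refine ⟨fun k => rigidMove c (-s) (p 0 0) (ps 0) (ps k), tendsto_pi_nhds.2 fun k => ?_,
    fun i j => norm_rigidMove_sub _ _ hcs' _ _, chi_rigidMove hcs' _ _ _, ?_⟩
  · have := ((continuous_rigidMove (c := c) (s := -s) (p 0 0) (ps 0)).tendsto _).comp
      (hal.bounded_and_tendsto hG hps hα hT k).2
    simpa only [Function.comp_def, rigidMove_inverse _ _ hcs] using this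
  · rw [stackedErr_rigidMove hcs', stackedErr_self]

theorem isAsympStable_stackedErr (hG : IsLFF G) (hps : ps 0 ≠ ps 1) (hα : 0 < α 1)
    (hT : ∀ i j k, IsTri G i j k → IsAgentTarget (α k) (β k) (ps i) (ps j) (ps k)) :
    IsAsympStable {x : ℝ → (EdgeIdx G → ℝ) × (TriIdx G → ℝ) |
      ∃ p, IsClosedLoop G ps α β p ∧ x = fun t => stackedErr G ps (p t)} 0 := by
  -- Coincidence of the first two agents would make their distance error `-‖ps 1 - ps 0‖ ^ 2`, which
  -- is bounded away from `0`.
  have hbase : ∀ᶠ x in 𝓝 (0 : (EdgeIdx G → ℝ) × (TriIdx G → ℝ)),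
      ∀ q : Fin (n + 2) → Plane, stackedErr G ps q = x → q 0 ≠ q 1 := by
    have hc : Continuous fun x : (EdgeIdx G → ℝ) × (TriIdx G → ℝ) =>
        x.1 ⟨(1, 0), hG.adj_one_zero⟩ := by fun_prop
    have hd : 0 < ‖ps 1 - ps 0‖ ^ 2 := by
      have := norm_pos_iff.2 (sub_ne_zero.2 hps.symm); positivity
    have := (hc.tendsto 0).eventually (lt_mem_nhds (a := -‖ps 1 - ps 0‖ ^ 2) (by simpa using hd))
    filter_upwards [this] with x hx q hq hq01
    rw [← hq] at hx
    simp [stackedErr, zErr, dist_des, hq01] at hx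
  constructor
  · intro U hU
    have hU' : ∀ᶠ q in 𝓝 ps, stackedErr G ps q ∈ U := by
      have := (continuous_stackedErr (G := G) (ps := ps)).tendsto ps
      rw [stackedErr_self] at this
      exact this hU
    obtain ⟨ε, hε, hεU⟩ := Metric.eventually_nhds_iff.1 hU'
    refine ⟨_, inter_mem hbase
      (eventually_all.2 fun k => eventually_stable hG hps hα hT k ε hε), ?_⟩
    rintro _ ⟨p, hp, rfl⟩ ⟨h0, hst⟩ t ht
    obtain ⟨c, s, hcs, hal⟩ := exists_aligned hps hp (h0 (p 0) rfl)
    have := @hεU (fun k => rigidMove c s (ps 0) (p 0 0) (p t k)) ((dist_pi_lt_iff hε).2 fun k =>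
      hst k _ hal (stackedErr_rigidMove hcs _ _ _) t ht)
    rwa [stackedErr_rigidMove hcs] at this
  · refine ⟨_, hbase, ?_⟩
    rintro _ ⟨p, hp, rfl⟩ h0
    obtain ⟨q, hq, -, -, hq0⟩ := exists_limit hG hps hα hT hp (h0 (p 0) rfl)
    have := ((continuous_stackedErr (G := G) (ps := ps)).tendsto q).comp hq
    rwa [hq0] at this

end Formation

end

/-! ### The main theorem. -/

theorem theorem1 {n : ℕ} (G : Digraph (Fin (n + 2))) (hG : IsLFF G)
    (ps : Fin (n + 2) → Plane) (hps : Function.Injective ps)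
    (htri : ∀ i j k : Fin (n + 2), IsTri G i j k →
      |(dist_des ps k i ^ 2 - dist_des ps k j ^ 2) / dist_des ps j i ^ 2| < 2 * Real.sqrt 2) :
    -- the lower bounds on the gain ratios exist for all nondegenerate non-isosceles triangles
    (∀ i j k : Fin (n + 2), IsTri G i j k → signedArea (ps i) (ps j) (ps k) ≠ 0 →
      dist_des ps k i ≠ dist_des ps k j →
      ∃ g : ℝ, IsGainBound (dist_des ps j i) (dist_des ps k j) (dist_des ps k i) g) ∧
    -- gains above any such bounds achieve the formation
    (∀ α β g : Fin (n + 2) → ℝ,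
      (∀ k : Fin (n + 2), 0 < k → 0 < α k) →
      (∀ k : Fin (n + 2), 1 < k → 0 < β k) →
      (∀ i j k : Fin (n + 2), IsTri G i j k → dist_des ps k i = dist_des ps k j →
        (dist_des ps k j ^ 2 - dist_des ps j i ^ 2 / 4) / dist_des ps j i ^ 2 < β k / α k) →
      (∀ i j k : Fin (n + 2), IsTri G i j k → dist_des ps k i ≠ dist_des ps k j →
        IsGainBound (dist_des ps j i) (dist_des ps k j) (dist_des ps k i) (g k) ∧
          g k < β k / α k) →
      IsAsympStable
        {x : ℝ → (EdgeIdx G → ℝ) × (TriIdx G → ℝ) |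
          ∃ p, IsClosedLoop G ps α β p ∧ x = fun t => stackedErr G ps (p t)} 0 ∧
      (∀ p₀ : Fin (n + 2) → Plane, p₀ 0 ≠ p₀ 1 →
        (∃ p, IsClosedLoop G ps α β p ∧ p 0 = p₀) ∧
        (∀ p, IsClosedLoop G ps α β p → p 0 = p₀ →
          Tendsto (fun t => stackedErr G ps (p t)) atTop (𝓝 0) ∧
          Tendsto (fun t => Metric.infDist (p t) (SCgt G ps)) atTop (𝓝 0) ∧
          (∀ i j, Tendsto (fun t => ‖p t j - p t i‖) atTop (𝓝 (dist_des ps j i))) ∧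
          Tendsto (fun t => chi G (p t)) atTop (𝓝 (chi G ps))))) := by
  have h01 : (0 : Fin (n + 2)) < 1 := by simp
  have hps01 : ps 0 ≠ ps 1 := hps.ne h01.ne
  have hbase : ∀ i j k : Fin (n + 2), IsTri G i j k → ps i ≠ ps j := fun i j k h => hps.ne h.1.ne
  refine ⟨fun i j k hijk hS hne => exists_isGainBound (hbase i j k hijk) (htri i j k hijk) hS hne,
    fun α β g hα hβ hiso hgain => ?_⟩
  have hT : ∀ i j k, IsTri G i j k → IsAgentTarget (α k) (β k) (ps i) (ps j) (ps k) := by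
    intro i j k hijk
    have hαk := hα k (h01.trans hijk.one_lt)
    have hβk := hβ k hijk.one_lt
    exact ⟨hαk, hβk, hbase i j k hijk, fun x => agentField_eq_zero_iff (hbase i j k hijk) hαk hβk
      (hiso i j k hijk) (fun hne => ⟨g k, hgain i j k hijk hne⟩)⟩
  have hα1 := hα 1 h01
  refine ⟨isAsympStable_stackedErr hG hps01 hα1 hT, fun p₀ hp₀ =>
    ⟨exists_isClosedLoop hG ps hα hβ p₀, fun p hp hp0 => ?_⟩⟩
  obtain ⟨q, hq, hnorm, hchi, herr⟩ := exists_limit hG hps01 hα1 hT hp (by rwa [hp0])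
  refine ⟨?_, ?_, fun i j => ?_, ?_⟩
  · have := ((continuous_stackedErr (G := G) (ps := ps)).tendsto q).comp hq
    rwa [herr] at this
  · exact squeeze_zero (fun _ => Metric.infDist_nonneg)
      (fun t => Metric.infDist_le_dist_of_mem ⟨hnorm, hchi⟩) (tendsto_iff_dist_tendsto_zero.1 hq)
  · have := ((tendsto_pi_nhds.1 hq j).sub (tendsto_pi_nhds.1 hq i)).norm
    rwa [hnorm] at this
  · have := ((continuous_chi (G := G)).tendsto q).comp hq
    rwa [hchi] at this
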